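/- Let $F$ be a finite field with $q$ elements, $T$ the theory of algebraically closed fields containing $F$, and $\Omega$ a model of $T$ (an algebraically closed field containing $F$). "Definable" means definable in the language of rings with parameters in $F$. Let $K(T)$ be the Grothendieck ring of definable sets (generated by the classes $[S]$ of definable sets $S\subseteq\Omega^m$, with the relations $[S\times S']=[S][S']$, $[\mathrm{pt}]=1$, $[S\sqcup S']=[S]+[S']$, and $[S]=[S']$ whenever there is a definable bijection $S\to S'$), and let $\mu_F:K(T)\to\mathbb Z$ be the ring homomorphism $[S]\mapsto |S(F)|=|S\cap F^m|$. More generally, let $K$ be any commutative $K(T)$-algebra and $\mu_F: K\to\mathbb C$ any ring homomorphism extending the point count on $K(T)$; write again $\mu_F$ for the induced map $K[[t]]\to\mathbb C[[t]]$. Let $X$ be a scheme of finite type over $F$ and $\mathcal U\to X$ a morphism of finite type; regard $X(\Omega)$ and $\mathcal U(\Omega)$ as definable sets through affine coordinates. For $x\in X(\Omega)$ let $a(x)=[\mathcal U_x]$, and define the motivic product $$\prod_{x\in X}(1+a(x)t)=\sum_{n\ge 0} b_n t^n\in K[[t]],\qquad b_n=\sum_{s\in \mathrm{Sym}_n(X)}\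 \prod_{x\in s}a(x),$$ where $\mathrm{Sym}_n(X)$ is the set of $n$-element subsets of $X(\Omega)$; that is, $b_n$ is the class of the definable set of all pairs $(s,\sigma)$ with $s\in \mathrm{Sym}_n(X)$ and $\sigma$ a section of $\mathcal U(\Omega)\to X(\Omega)$ over $s$ (a set of finite sets, identified definably with a definable subset of some $\Omega^m$). For a closed point $v$ of $X$ let $F_v$ be its residue field, $q_v=|F_v|$, $\deg v=[F_v:F]$, let $\mathcal U_v$ be the fiber of $\mathcal U$ over $v$, and $a(v)=|\mathcal U_v(F_v)|$. Then the motivic product exists, and: 1. As formal power series in $t$, $$\prod_{v\in X_{\mathrm{closed}}}\bigl(1+a(v)t^{\deg v}\bigr)=\mu_F\prod_{x\in X}(1+a(x)t),$$ where the left side is the coefficientwise limit: for each $N$, the coefficient of $t^N$ of the product over a finite set $S$ of closed points is constant once $S$ is large enough. (For $t=q^{-s}$ the factors on the left are $1+a(v)q_v^{-s}$.) 2. If $s\in\mathbb C$ is such that $\sum_v |a(v)q_v^{-s}|<\infty$, that is, the product $\prod_{v\in X_{\mathrm{closed}}}(1+a(v)q_v^{-s})$ converges absolutely, and $r\in\mathbb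 C$ is its value, then the power series $\mu_F\prod_{x\in X}(1+a(x)t)=\sum_n\mu_F(b_n)t^n$ converges absolutely at $t=q^{-s}$, with sum $r$. -/

import Mathlib

open CategoryTheory AlgebraicGeometry

universe u

noncomputable section

namespace MotivicEuler

/-! ### Definable sets of the theory of algebraically closed fields over `F`

`Ω` is a model, i.e. an algebraically closed field containing `F`.  As the theory of algebraically
closed `F`-algebras is complete, definable sets and definable maps may be taken in `Ω`. -/

/-- `s ⊆ Ω ^ α` is definable, in the language of rings, with parameters from `F`. -/
def IsDefinable (F : Type*) {Ω : Type*} [Field F] [Field Ω] [Algebra F Ω] {α : Type*}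
    (s : Set (α → Ω)) : Prop :=
  letI := FirstOrder.Ring.compatibleRingOfRing Ω
  (Set.range (algebraMap F Ω)).Definable FirstOrder.Language.ring s

section Basic

variable {F : Type*} {Ω : Type*} [Field F] [Field Ω] [Algebra F Ω]

theorem IsDefinable.univ {α : Type*} : IsDefinable F (Set.univ : Set (α → Ω)) := by
  unfold IsDefinable
  let _ := FirstOrder.Ring.compatibleRingOfRing Ω
  exact Set.definable_univ

theorem IsDefinable.union {α : Type*} {s t : Set (α → Ω)} (hs : IsDefinable F s)
    (ht : IsDefinable F t) : IsDefinable F (s ∪ t) := by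
  unfold IsDefinable at *
  let _ := FirstOrder.Ring.compatibleRingOfRing Ω
  exact Set.Definable.union hs ht

theorem IsDefinable.inter {α : Type*} {s t : Set (α → Ω)} (hs : IsDefinable F s)
    (ht : IsDefinable F t) : IsDefinable F (s ∩ t) := by
  unfold IsDefinable at *
  let _ := FirstOrder.Ring.compatibleRingOfRing Ω
  exact Set.Definable.inter hs ht

theorem IsDefinable.preimage_comp {α β : Type*} {s : Set (α → Ω)} (hs : IsDefinable F s)
    (j : α → β) : IsDefinable F ((fun w : β → Ω => w ∘ j) ⁻¹' s) := by
  unfold IsDefinable at *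
  let _ := FirstOrder.Ring.compatibleRingOfRing Ω
  exact Set.Definable.preimage_comp j hs

/-- Definable sets over `F` are stable under the automorphisms of `Ω` over `F`. -/
theorem IsDefinable.map_mem {α : Type*} {s : Set (α → Ω)} (hs : IsDefinable F s) (σ : Ω ≃ₐ[F] Ω)
    {w : α → Ω} (hw : w ∈ s) : (fun i => σ (w i)) ∈ s := by
  let _ := FirstOrder.Ring.compatibleRingOfRing Ω
  unfold IsDefinable at hs
  obtain ⟨φ, rfl⟩ := Set.definable_iff_exists_formula_sum.1 hs
  have key := FirstOrder.Language.StrongHomClass.realize_formula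
    (FirstOrder.Ring.languageEquivEquivRingEquiv.symm σ.toRingEquiv :
      FirstOrder.Language.ring.Equiv Ω Ω) φ
    (v := Sum.elim ((↑) : Set.range (algebraMap F Ω) → Ω) w)
  have h2 : ((FirstOrder.Ring.languageEquivEquivRingEquiv.symm σ.toRingEquiv :
      FirstOrder.Language.ring.Equiv Ω Ω) ∘
        Sum.elim ((↑) : Set.range (algebraMap F Ω) → Ω) w) =
      Sum.elim ((↑) : Set.range (algebraMap F Ω) → Ω) (fun i => σ (w i)) := by
    funext i
    rcases i with ⟨_, a, rfl⟩ | i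
    · exact σ.commutes a
    · rfl
  rw [h2] at key
  exact key.2 hw

end Basic

/-- A definable set over `F`: a definable subset of some affine space `Ω ^ dim`. -/
structure DefSet (F Ω : Type u) [Field F] [Field Ω] [Algebra F Ω] where
  dim : ℕ
  carrier : Set (Fin dim → Ω)
  definable : IsDefinable F carrier

variable {F Ω : Type u} [Field F] [Field Ω] [Algebra F Ω]

namespace DefSet

/-- The product of two definable sets. -/
def prod (A B : DefSet F Ω) : DefSet F Ω where
  dim := A.dim + B.dim
  carrier := {w | w ∘ Fin.castAdd B.dim ∈ A.carrier ∧ w ∘ Fin.natAdd A.dim ∈ B.carrier}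
  definable := (A.definable.preimage_comp _).inter (B.definable.preimage_comp _)

/-- The disjoint union of two definable subsets of the same affine space. -/
def union (m : ℕ) (s t : Set (Fin m → Ω)) (hs : IsDefinable F s) (ht : IsDefinable F t) :
    DefSet F Ω :=
  ⟨m, s ∪ t, hs.union ht⟩

/-- The one point definable set `Ω ^ 0`. -/
def point (F Ω : Type u) [Field F] [Field Ω] [Algebra F Ω] : DefSet F Ω :=
  ⟨0, Set.univ, IsDefinable.univ⟩

/-- A map between definable sets is definable if its graph is. -/
def IsDefinableMap {A B : DefSet F Ω} (f : A.carrier → B.carrier) : Prop :=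
  IsDefinable F {w : Fin A.dim ⊕ Fin B.dim → Ω |
    ∃ a : A.carrier, w = Sum.elim a.1 (f a).1}

/-- The `F`-rational points of a definable set. -/
abbrev rationalPoints (A : DefSet F Ω) : Type u :=
  {x : Fin A.dim → F // (fun i => algebraMap F Ω (x i)) ∈ A.carrier}

end DefSet

/-! ### The Grothendieck ring -/

/-- The defining relations of the Grothendieck ring of definable sets. -/
inductive GrothendieckRel (F Ω : Type u) [Field F] [Field Ω] [Algebra F Ω] :
    MvPolynomial (DefSet F Ω) ℤ → MvPolynomial (DefSet F Ω) ℤ → Prop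
  | one : GrothendieckRel F Ω (.X (.point F Ω)) 1
  | mul (A B : DefSet F Ω) : GrothendieckRel F Ω (.X (A.prod B)) (.X A * .X B)
  | add (m : ℕ) (s t : Set (Fin m → Ω)) (hs : IsDefinable F s) (ht : IsDefinable F t)
      (hst : Disjoint s t) :
      GrothendieckRel F Ω (.X (.union m s t hs ht)) (.X ⟨m, s, hs⟩ + .X ⟨m, t, ht⟩)
  | bij (A B : DefSet F Ω) (f : A.carrier ≃ B.carrier) (hf : DefSet.IsDefinableMap f) :
      GrothendieckRel F Ω (.X A) (.X B)

/-- The Grothendieck ring of definable sets, with coefficients in `F`, of the theory of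
algebraically closed fields, presented by generators and relations. -/
abbrev GrothendieckRing (F Ω : Type u) [Field F] [Field Ω] [Algebra F Ω] : Type u :=
  RingQuot (GrothendieckRel F Ω)

/-- The class of a definable set in the Grothendieck ring. -/
def DefSet.cls (A : DefSet F Ω) : GrothendieckRing F Ω :=
  RingQuot.mkRingHom (GrothendieckRel F Ω) (.X A)

/-! ### Counting rational points -/

theorem card_rationalPoints_point : Nat.card (DefSet.point F Ω).rationalPoints = 1 := by
  rw [Nat.card_eq_one_iff_unique]
  refine ⟨⟨fun x y => Subtype.ext (Subsingleton.elim (α := Fin 0 → F) _ _)⟩,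
    ⟨⟨Fin.elim0, trivial⟩⟩⟩

section Count

variable [Finite F]

instance (A : DefSet F Ω) : Finite A.rationalPoints := inferInstance

theorem exists_algEquiv_fixed [IsAlgClosed Ω] : ∃ σ : Ω ≃ₐ[F] Ω, ∀ y : Ω,
    σ y = y ↔ y ∈ Set.range (algebraMap F Ω) := by
  have := Fintype.ofFinite F
  obtain ⟨p, hp⟩ := CharP.exists F
  have : Fact p.Prime := ⟨CharP.char_is_prime F p⟩
  have : CharP Ω p := charP_of_injective_algebraMap (algebraMap F Ω).injective p
  have : ExpChar Ω p := ExpChar.prime Fact.out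
  refine ⟨FiniteField.frobeniusAlgEquiv F Ω p, fun y => ?_⟩
  rw [FiniteField.frobeniusAlgEquiv_apply]
  constructor
  · intro h
    have h1 : (Polynomial.X ^ Fintype.card F - Polynomial.X : Polynomial F) =
        ((Finset.univ : Finset F).val.map fun a => Polynomial.X - Polynomial.C a).prod := by
      have := FiniteField.roots_X_pow_card_sub_X F
      rw [← this]
      symm
      apply Polynomial.prod_multiset_X_sub_C_of_monic_of_roots_card_eq
      · exact Polynomial.monic_X_pow_sub (by
          rw [Polynomial.degree_X]; exact_mod_cast Fintype.one_lt_card)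
      · rw [this, FiniteField.X_pow_card_sub_X_natDegree_eq F Fintype.one_lt_card]
        rfl
    have h2 := congrArg (Polynomial.aeval y) h1
    rw [map_sub, map_pow, Polynomial.aeval_X, h, sub_self] at h2
    have h3 : ∏ a : F, (y - algebraMap F Ω a) = 0 := by
      rw [h2]
      rw [← Finset.prod_eq_multiset_prod, map_prod]
      simp
    obtain ⟨a, -, ha⟩ := Finset.prod_eq_zero_iff.1 h3
    exact ⟨a, (sub_eq_zero.1 ha).symm⟩
  · rintro ⟨a, rfl⟩
    rw [← map_pow, FiniteField.pow_card]

/-- A definable bijection matches rational points. -/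
theorem card_rationalPoints_eq [IsAlgClosed Ω] {A B : DefSet F Ω} (f : A.carrier ≃ B.carrier)
    (hf : DefSet.IsDefinableMap f) : Nat.card A.rationalPoints = Nat.card B.rationalPoints := by
  obtain ⟨σ, hσ⟩ := exists_algEquiv_fixed (F := F) (Ω := Ω)
  have key : ∀ a : A.carrier, (∀ i, a.1 i ∈ Set.range (algebraMap F Ω)) ↔
      ∀ i, (f a).1 i ∈ Set.range (algebraMap F Ω) := by
    intro a
    obtain ⟨a', ha'⟩ := hf.map_mem σ ⟨a, rfl⟩
    have e1 : (fun i => σ (a.1 i)) = a'.1 := by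
      funext i; exact congrFun ha' (Sum.inl i)
    have e2 : (fun i => σ ((f a).1 i)) = (f a').1 := by
      funext i; exact congrFun ha' (Sum.inr i)
    have c1 : (∀ i, a.1 i ∈ Set.range (algebraMap F Ω)) ↔ a' = a := by
      rw [Subtype.ext_iff, ← e1, funext_iff]
      exact forall_congr' fun i => (hσ _).symm
    have c2 : (∀ i, (f a).1 i ∈ Set.range (algebraMap F Ω)) ↔ f a' = f a := by
      rw [Subtype.ext_iff, ← e2, funext_iff]
      exact forall_congr' fun i => (hσ _).symm
    rw [c1, c2, f.injective.eq_iff]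
  have equ : ∀ C : DefSet F Ω, Nat.card C.rationalPoints =
      Nat.card {c : C.carrier // ∀ i, c.1 i ∈ Set.range (algebraMap F Ω)} := by
    intro C
    refine Nat.card_congr (Equiv.ofBijective
      (fun x => ⟨⟨fun i => algebraMap F Ω (x.1 i), x.2⟩, fun i => ⟨x.1 i, rfl⟩⟩) ⟨?_, ?_⟩)
    · intro x y hxy
      apply Subtype.ext
      funext i
      have := congrArg (fun c => c.1.1 i) hxy
      exact (algebraMap F Ω).injective this
    · rintro ⟨⟨c, hc⟩, h⟩
      choose x hx using id h
      have hx' : (fun i => algebraMap F Ω (x i)) = c := funext hx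
      exact ⟨⟨x, by rw [hx']; exact hc⟩, Subtype.ext (Subtype.ext hx')⟩
  rw [equ A, equ B]
  exact Nat.card_congr (f.subtypeEquiv key)

theorem card_rationalPoints_prod (A B : DefSet F Ω) :
    Nat.card (A.prod B).rationalPoints = Nat.card A.rationalPoints * Nat.card B.rationalPoints := by
  rw [← Nat.card_prod]
  refine Nat.card_congr
    { toFun x := (⟨x.1 ∘ Fin.castAdd B.dim, x.2.1⟩, ⟨x.1 ∘ Fin.natAdd A.dim, x.2.2⟩)
      invFun x := ⟨Fin.append x.1.1 x.2.1, ?_, ?_⟩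
      left_inv := ?_
      right_inv := ?_ }
  · have h : (fun i => algebraMap F Ω (Fin.append x.1.1 x.2.1 i)) ∘ Fin.castAdd B.dim =
        fun i => algebraMap F Ω (x.1.1 i) :=
      funext fun i => congrArg (algebraMap F Ω) (Fin.append_left x.1.1 x.2.1 i)
    exact (congrArg (· ∈ A.carrier) h).mpr x.1.2
  · have h : (fun i => algebraMap F Ω (Fin.append x.1.1 x.2.1 i)) ∘ Fin.natAdd A.dim =
        fun i => algebraMap F Ω (x.2.1 i) :=
      funext fun i => congrArg (algebraMap F Ω) (Fin.append_right x.1.1 x.2.1 i)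
    exact (congrArg (· ∈ B.carrier) h).mpr x.2.2
  · rintro ⟨x, hx⟩
    apply Subtype.ext
    exact Fin.append_castAdd_natAdd
  · rintro ⟨⟨x, hx⟩, ⟨y, hy⟩⟩
    refine Prod.ext (Subtype.ext ?_) (Subtype.ext ?_)
    · exact funext fun i => Fin.append_left x y i
    · exact funext fun i => Fin.append_right x y i

theorem card_rationalPoints_union (m : ℕ) (s t : Set (Fin m → Ω)) (hs : IsDefinable F s)
    (ht : IsDefinable F t) (hst : Disjoint s t) :
    Nat.card (DefSet.union m s t hs ht).rationalPoints =
      Nat.card (⟨m, s, hs⟩ : DefSet F Ω).rationalPoints +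
        Nat.card (⟨m, t, ht⟩ : DefSet F Ω).rationalPoints := by
  classical
  rw [← Nat.card_sum]
  refine Nat.card_congr (subtypeOrEquiv _ _ ?_)
  rw [Pi.disjoint_iff]
  intro x
  rw [Prop.disjoint_iff, not_and]
  exact fun h1 h2 => Set.disjoint_left.1 hst h1 h2

/-- The ring homomorphism from the Grothendieck ring to `ℤ` that sends the class of a definable
set to the number of its `F`-rational points. -/
def pointCount (F Ω : Type u) [Field F] [Field Ω] [Algebra F Ω] [Finite F] [IsAlgClosed Ω] :
    GrothendieckRing F Ω →+* ℤ :=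
  RingQuot.lift
    ⟨(MvPolynomial.aeval fun A : DefSet F Ω => (Nat.card A.rationalPoints : ℤ) :
        MvPolynomial (DefSet F Ω) ℤ →ₐ[ℤ] ℤ).toRingHom, by
      intro x y h
      cases h with
      | one => simp [card_rationalPoints_point]
      | mul A B => simp [card_rationalPoints_prod]
      | add m s t hs ht hst => simp [card_rationalPoints_union m s t hs ht hst]
      | bij A B f hf => simp [card_rationalPoints_eq f hf]⟩

theorem pointCount_cls [IsAlgClosed Ω] (A : DefSet F Ω) :
    pointCount F Ω A.cls = Nat.card A.rationalPoints := by
  simp [pointCount, DefSet.cls]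

end Count

/-! ### The motivic Euler product of a definable family -/

/-- For a map `f : Y → X` of sets: the pairs `(s, σ)` of an `n`-element subset `s` of `X` and a
section `σ` of `f` over `s`.  This is the total space of the family
`s ↦ ∏_{x ∈ s} f ⁻¹ (x)` over the set of `n`-element subsets of `X`. -/
def SymSections {Y X : Type*} (f : Y → X) (n : ℕ) : Type _ :=
  Σ s : {s : Finset X // s.card = n}, ∀ x : s.1, {y : Y // f y = x}

/-- `c = ∑_{s ∈ Sym_n(X)} ∏_{x ∈ s} [Y_x]`, the class of the total space `SymSections f n`.
Being a set of finite sets, this space is identified with a definable set `B`; the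
identification `κ` has to be definable, in the sense that the relation
"`(y₁, …, yₙ)` enumerates the values of the section `p`, and `b = κ p`" is definable. -/
def IsMotivicCoeff {Y X : DefSet F Ω} (f : Y.carrier → X.carrier) (n : ℕ)
    (c : GrothendieckRing F Ω) : Prop :=
  ∃ (B : DefSet F Ω) (κ : SymSections f n ≃ B.carrier),
    IsDefinable F {w : (Fin n × Fin Y.dim) ⊕ Fin B.dim → Ω |
      ∃ (p : SymSections f n) (x : Fin n ≃ p.1.1),
        w = Sum.elim (fun ij => (p.2 (x ij.1)).1.1 ij.2) (κ p).1} ∧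
    c = B.cls

/-- `P` is the motivic product `∏_{x ∈ X} (1 + [Y_x] t) = ∑ₙ bₙ tⁿ` of the definable family
`f : Y → X`. -/
def IsMotivicProduct {Y X : DefSet F Ω} (f : Y.carrier → X.carrier)
    (P : PowerSeries (GrothendieckRing F Ω)) : Prop :=
  DefSet.IsDefinableMap f ∧ ∀ n, IsMotivicCoeff f n (PowerSeries.coeff n P)

/-! ### Schemes over `F` as definable sets -/

/-- The set `X(Ω)` of `Ω`-points of the `F`-scheme `π : X ⟶ Spec F`. -/
def GeomPoint (Ω : Type u) [Field Ω] [Algebra F Ω] {X : Scheme.{u}} (π : X ⟶ Spec (.of F)) :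
    Type u :=
  {x : Spec (.of Ω) ⟶ X // x ≫ π = Spec.map (CommRingCat.ofHom (algebraMap F Ω))}

/-- The map `U(Ω) → X(Ω)` induced by a morphism `g : U ⟶ X`. -/
def GeomPoint.map {X U : Scheme.{u}} (π : X ⟶ Spec (.of F)) (g : U ⟶ X)
    (y : GeomPoint Ω (g ≫ π)) : GeomPoint Ω π :=
  ⟨y.1 ≫ g, by rw [Category.assoc]; exact y.2⟩

/-- The value in `Ω` of a regular function at an `Ω`-point. -/
def evalAt {V : Scheme.{u}} (y : Spec (.of Ω) ⟶ V) (f : Γ(V, ⊤)) : Ω :=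
  (Scheme.ΓSpecIso (.of Ω)).hom (y.appTop f)

/-- `e` identifies `X(Ω)` with the definable set `S` as definable sets: every regular function
on every open subscheme of `X` becomes a definable partial function on `S`.  As `X` is covered by
finitely many affine open subschemes of finite type, this determines `S` up to definable
bijection. -/
def IsRealization {X : Scheme.{u}} (π : X ⟶ Spec (.of F)) (S : DefSet F Ω)
    (e : GeomPoint Ω π ≃ S.carrier) : Prop :=
  ∀ (V : X.Opens) (f : Γ(V, ⊤)),
    IsDefinable F {w : Unit ⊕ Fin S.dim → Ω |
      ∃ (y : Spec (.of Ω) ⟶ V)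
        (hy : (y ≫ V.ι) ≫ π = Spec.map (CommRingCat.ofHom (algebraMap F Ω))),
        w = Sum.elim (fun _ => evalAt y f) (e ⟨y ≫ V.ι, hy⟩).1}

/-- `P` is the motivic product `∏_{x ∈ X} (1 + a(x) t)`, where `a(x) = [U_x]`, for schemes
`g : U ⟶ X` and `π : X ⟶ Spec F` of finite type. -/
def IsSchemeMotivicProduct (Ω : Type u) [Field Ω] [Algebra F Ω] {X U : Scheme.{u}}
    (π : X ⟶ Spec (.of F)) (g : U ⟶ X) (P : PowerSeries (GrothendieckRing F Ω)) : Prop :=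
  ∃ (SX SU : DefSet F Ω) (eX : GeomPoint Ω π ≃ SX.carrier)
    (eU : GeomPoint Ω (g ≫ π) ≃ SU.carrier),
    IsRealization π SX eX ∧ IsRealization (g ≫ π) SU eU ∧
      IsMotivicProduct (fun y : SU.carrier => eX (GeomPoint.map π g (eU.symm y))) P

/-! ### Closed points -/

/-- The closed points of a scheme. -/
abbrev ClosedPoint (X : Scheme.{u}) : Type u := {v : X // IsClosed ({v} : Set X)}

/-- The number `q_v` of elements of the residue field at `v`. -/
def residueCard {X : Scheme.{u}} (v : X) : ℕ := Nat.card (X.residueField v)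

/-- The degree over `F` of the residue field at `v`. -/
def residueDegree {X : Scheme.{u}} (π : X ⟶ Spec (.of F)) (v : X) : ℕ :=
  letI : Algebra F (X.residueField v) :=
    (Spec.preimage (X.fromSpecResidueField v ≫ π)).hom.toAlgebra
  Module.finrank F (X.residueField v)

/-- The number `a(v)` of `F_v`-points of the fiber `U_v`, where `F_v` is the residue field
at `v`. -/
def fiberCount {X U : Scheme.{u}} (g : U ⟶ X) (v : X) : ℕ :=
  Nat.card {h : Spec (X.residueField v) ⟶ g.fiber v // h ≫ g.fiberToSpecResidueField v = 𝟙 _}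

end MotivicEuler

end

open MotivicEuler

open CategoryTheory AlgebraicGeometry

noncomputable section

namespace MotivicEuler

/-! ### Closure properties of definable sets -/

section Definable

variable {F Ω : Type*} [Field F] [Field Ω] [Algebra F Ω] {α β : Type*}

/-! Let `σ` be the `q`-power Frobenius of `Ω`. Definable sets over `F` are stable under `σ`,
definable maps commute with it, and `F`-rational points are its fixed points. A point of the
definable set behind `b_n` amounts to an `n`-element subset `T` of `U(Ω)` on which `U(Ω) → X(Ω)` is
injective, so `μ_F(b_n)` counts the Frobenius-stable sets `T` of this kind
(`IsMotivicCoeff.pointCount_eq`).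

The finite Frobenius orbits in `X(Ω)` are the closed points `v` of `X`, and the orbit of `v` has
`deg v` elements (`minimalPeriod_pointOf`, `exists_orbit_of_periodic`). The image of a stable `T` is
thus the union of the orbits of a finite set `D` of closed points with total degree `n`. Fix a
geometric point `x_v` over each `v`. Then `T` is determined by its points above the `x_v`, `v ∈ D`.
Injectivity on `T` forces such a point to be fixed by `σ ^ deg v`, and any choice of fixed points
occurs (`card_stable_eq_sum`). The fixed points above `x_v` are the `F_v`-points of the fibre, by
descent along `F_v → Ω` (`fiberCount_eq`). Hence `μ_F(b_n) = ∑_D ∏_{v ∈ D} a(v)`, which is the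
coefficient of `t ^ n` in the expanded Euler product. Convergence follows by expanding an absolutely
convergent product over finite subsets and grouping the terms by degree, with `q_v = q ^ deg v`.

For existence, `X(Ω)` and `U(Ω)` are embedded in affine space by chart coordinates extended by zero
(`exists_isRealization`), and morphisms become definable maps (`isDefinableMap_geomPointMap`).
Finite subsets are coded by the coefficients of a polynomial that has their elements as roots
(`exists_symmetric_encoding`, `exists_isMotivicCoeff`). -/

theorem IsDefinable.compl {s : Set (α → Ω)} (hs : IsDefinable F s) : IsDefinable F sᶜ := by
  unfold IsDefinable at *
  let _ := FirstOrder.Ring.compatibleRingOfRing Ω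
  exact Set.Definable.compl hs

theorem IsDefinable.iUnion {ι : Type*} [Finite ι] {s : ι → Set (α → Ω)}
    (hs : ∀ i, IsDefinable F (s i)) : IsDefinable F (⋃ i, s i) := by
  unfold IsDefinable at *
  let _ := FirstOrder.Ring.compatibleRingOfRing Ω
  exact Set.definable_iUnion_of_finite hs

theorem IsDefinable.iInter {ι : Type*} [Finite ι] {s : ι → Set (α → Ω)}
    (hs : ∀ i, IsDefinable F (s i)) : IsDefinable F (⋂ i, s i) := by
  unfold IsDefinable at *
  let _ := FirstOrder.Ring.compatibleRingOfRing Ω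
  exact Set.definable_iInter_of_finite hs

theorem IsDefinable.and {P Q : (α → Ω) → Prop} (hP : IsDefinable F {w | P w})
    (hQ : IsDefinable F {w | Q w}) : IsDefinable F {w | P w ∧ Q w} := hP.inter hQ

theorem IsDefinable.not {P : (α → Ω) → Prop} (hP : IsDefinable F {w | P w}) :
    IsDefinable F {w | ¬ P w} := hP.compl

theorem IsDefinable.forall_finite {ι : Type*} [Finite ι] {P : ι → (α → Ω) → Prop}
    (hP : ∀ i, IsDefinable F {w | P i w}) : IsDefinable F {w | ∀ i, P i w} := by
  rw [Set.ofPred_forall]; exact .iInter hP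

theorem IsDefinable.exists_finite {ι : Type*} [Finite ι] {P : ι → (α → Ω) → Prop}
    (hP : ∀ i, IsDefinable F {w | P i w}) : IsDefinable F {w | ∃ i, P i w} := by
  rw [Set.ofPred_exists]; exact .iUnion hP

theorem IsDefinable.exists_vector [Finite α] [Finite β] {P : (α → Ω) → (β → Ω) → Prop}
    (hP : IsDefinable F {w : α ⊕ β → Ω | P (w ∘ Sum.inl) (w ∘ Sum.inr)}) :
    IsDefinable F {u | ∃ v, P u v} := by
  unfold IsDefinable at *
  let _ := FirstOrder.Ring.compatibleRingOfRing Ω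
  convert Set.Definable.image_comp hP (Sum.inl : α → α ⊕ β) using 1
  ext u
  constructor
  · rintro ⟨v, h⟩
    exact ⟨Sum.elim u v, by simpa using h, by simp⟩
  · rintro ⟨w, h, rfl⟩
    exact ⟨_, h⟩

theorem IsDefinable.mem_comp {s : Set (α → Ω)} (hs : IsDefinable F s) (j : α → β) :
    IsDefinable F {w : β → Ω | (fun i => w (j i)) ∈ s} := hs.preimage_comp j

theorem isDefinable_aeval_eq_zero (p : MvPolynomial α F) :
    IsDefinable F {w : α → Ω | MvPolynomial.aeval w p = 0} := by
  classical
  unfold IsDefinable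
  let _ := FirstOrder.Ring.compatibleRingOfRing Ω
  -- A zero locus is definable over the set of coefficients of its equations, and here these lie in
  -- the image of `F`.
  have h := (FirstOrder.Ring.mvPolynomial_zeroLocus_definable
    {MvPolynomial.map (algebraMap F Ω) p}).mono (B := Set.range (algebraMap F Ω)) (by
      simp only [Finset.mem_singleton, Set.iUnion_iUnion_eq_left]
      rintro _ ⟨i, -, rfl⟩
      exact ⟨p.coeff i, (MvPolynomial.coeff_map _ _ _).symm⟩)
  rw [MvPolynomial.zeroLocus_span] at h
  simpa [MvPolynomial.eval₂_map, MvPolynomial.aeval_def] using h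

theorem isDefinable_aeval_eq (p q : MvPolynomial α F) :
    IsDefinable F {w : α → Ω | MvPolynomial.aeval w p = MvPolynomial.aeval w q} := by
  simpa [sub_eq_zero] using isDefinable_aeval_eq_zero (Ω := Ω) (p - q)

theorem isDefinable_coord_eq_algebraMap (i : α) (c : F) :
    IsDefinable F {w : α → Ω | w i = algebraMap F Ω c} := by
  simpa using isDefinable_aeval_eq (Ω := Ω) (F := F) (.X i) (.C c)

theorem IsDefinable.empty : IsDefinable F (∅ : Set (α → Ω)) := by
  simpa using (IsDefinable.univ (F := F) (Ω := Ω) (α := α)).compl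

end Definable

/-! ### Finite sets of points as points -/

open Polynomial in
/-- Finite sequences of points up to order are parametrized by finitely many polynomials. -/
theorem exists_symmetric_encoding (F Ω : Type*) [Field F] [Field Ω] [Algebra F Ω] (n m : ℕ) :
    ∃ (N : ℕ) (P : Fin N → MvPolynomial (Fin n × Fin m) F), ∀ y y' : Fin n × Fin m → Ω,
      (∀ k, MvPolynomial.aeval y (P k) = MvPolynomial.aeval y' (P k)) ↔
        (Finset.univ.val.map fun i j => y (i, j)) = Finset.univ.val.map fun i j => y' (i, j) := by
  classical
  let R := MvPolynomial (Fin n × Fin m) F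
  -- The vector `y_i` is coded as the polynomial `∑ j, y_ij T ^ j`, and `E` is the generic monic
  -- polynomial with these `n` roots. Its finitely many nonzero coefficients, indexed by `I`, are
  -- the required symmetric functions.
  let E : R[X][X] := ∏ i : Fin n, (X - C (∑ j : Fin m, C (MvPolynomial.X (i, j)) * X ^ (j : ℕ)))
  let I : Finset (ℕ × ℕ) := E.support.biUnion fun k => (E.coeff k).support.image fun l => (k, l)
  have hI : ∀ k l, (k, l) ∉ I → (E.coeff k).coeff l = 0 := by
    intro k l h
    by_contra h0
    refine h (Finset.mem_biUnion.2 ⟨k, ?_, Finset.mem_image.2 ⟨l, ?_, rfl⟩⟩)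
    · rw [mem_support_iff]; rintro h1; simp [h1] at h0
    · rwa [mem_support_iff]
  let ev (y : Fin n × Fin m → Ω) : R →+* Ω := (MvPolynomial.aeval y : R →ₐ[F] Ω).toRingHom
  let L (v : Fin m → Ω) : Polynomial Ω := ∑ j : Fin m, C (v j) * X ^ (j : ℕ)
  have hL : Function.Injective L := by
    intro v v' h
    funext j
    have := congrArg (fun p => p.coeff j) h
    simpa [L, finsetSum_coeff, coeff_X_pow, Fin.val_inj] using this
  have hE : ∀ y, E.map (mapRingHom (ev y)) =
      (((Finset.univ.val.map fun i j => y (i, j)).map L).map fun a => X - C a).prod := by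
    intro y
    rw [Multiset.map_map, Multiset.map_map, ← Finset.prod_eq_multiset_prod]
    have hev : ∀ a, ev y (MvPolynomial.X a) = y a := fun a => MvPolynomial.aeval_X y a
    simp [E, Polynomial.map_prod, Polynomial.map_sum, hev, L]
  refine ⟨I.card, fun k => (E.coeff (I.equivFin.symm k).1.1).coeff (I.equivFin.symm k).1.2,
    fun y y' => ⟨fun h => ?_, fun h k => ?_⟩⟩
  · have h1 : E.map (mapRingHom (ev y)) = E.map (mapRingHom (ev y')) := by
      ext k l
      simp only [coeff_map, coe_mapRingHom]
      by_cases hkl : (k, l) ∈ I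
      · simpa using! h (I.equivFin ⟨_, hkl⟩)
      · simp [hI k l hkl]
    rw [hE, hE] at h1
    -- `Ω[T]` is a domain, so a product of monic linear factors determines the multiset of its
    -- roots.
    have h2 := congrArg Polynomial.roots h1
    rw [roots_multiset_prod_X_sub_C, roots_multiset_prod_X_sub_C] at h2
    exact Multiset.map_injective hL h2
  · have h1 : E.map (mapRingHom (ev y)) = E.map (mapRingHom (ev y')) := by rw [hE, hE, h]
    have h2 := congrArg (fun p => (p.coeff (I.equivFin.symm k).1.1).coeff
      (I.equivFin.symm k).1.2) h1
    simp only [coeff_map, coe_mapRingHom] at h2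
    exact h2

/-! ### Sections over finite sets as finite sets -/

namespace SymSections

variable {Y X : Type*} {f : Y → X} {n : ℕ}

/-- The finite set of values of a section. -/
def values (p : SymSections f n) : Finset Y :=
  p.1.1.attach.map ⟨fun x => (p.2 x).1, fun x x' h => by
    have := congrArg f h
    rw [(p.2 x).2, (p.2 x').2] at this
    exact Subtype.ext this⟩

theorem mem_values {p : SymSections f n} {y : Y} : y ∈ p.values ↔ ∃ x, (p.2 x).1 = y := by
  simp only [values, Finset.mem_map, Finset.mem_attach, true_and]; rfl

theorem card_values (p : SymSections f n) : p.values.card = n := by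
  simp [values, p.1.2]

theorem injOn_values (p : SymSections f n) : Set.InjOn f (p.values : Set Y) := by
  intro y hy y' hy' h
  obtain ⟨x, rfl⟩ := mem_values.1 hy
  obtain ⟨x', rfl⟩ := mem_values.1 hy'
  rw [(p.2 x).2, (p.2 x').2] at h
  rw [Subtype.ext h]

/-- The base set is the image of the values under `f`, and over each of its elements there is
exactly one value. -/
theorem values_injective : Function.Injective (values : SymSections f n → Finset Y) := by
  have key : ∀ p p' : SymSections f n, p.values = p'.values → p.1.1 ⊆ p'.1.1 := by
    intro p p' h x hx
    have := mem_values.2 ⟨⟨x, hx⟩, rfl⟩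
    rw [h] at this
    obtain ⟨x', hx'⟩ := mem_values.1 this
    have h2 : x'.1 = x := (p'.2 x').2.symm.trans ((congrArg f hx').trans (p.2 ⟨x, hx⟩).2)
    exact h2 ▸ x'.2
  intro p p' h
  have hs : p.1 = p'.1 := Subtype.ext ((key p p' h).antisymm (key p' p h.symm))
  obtain ⟨s, a⟩ := p
  obtain ⟨s', a'⟩ := p'
  obtain rfl : s = s' := hs
  congr 1
  funext x
  have := mem_values (p := ⟨s, a⟩) (y := (a x).1) |>.2 ⟨x, rfl⟩
  rw [h] at this
  obtain ⟨x', hx'⟩ := mem_values.1 this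
  have h2 := congrArg f hx'
  obtain rfl : x' = x := Subtype.ext ((a' x').2.symm.trans (h2.trans (a x).2))
  exact Subtype.ext hx'.symm

theorem exists_values_eq {T : Finset Y} (hT : T.card = n) (hf : Set.InjOn f (T : Set Y)) :
    ∃ p : SymSections f n, p.values = T := by
  classical
  have h : ∀ x : T.image f, ∃ y : {y : Y // f y = x}, y.1 ∈ T := by
    rintro ⟨x, hx⟩
    obtain ⟨y, hy, rfl⟩ := Finset.mem_image.1 hx
    exact ⟨⟨y, rfl⟩, hy⟩
  choose a ha using h
  refine ⟨⟨⟨T.image f, by rw [Finset.card_image_of_injOn hf, hT]⟩, a⟩, ?_⟩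
  ext y
  refine mem_values.trans ⟨?_, ?_⟩
  · rintro ⟨x, rfl⟩
    exact ha x
  · intro hy
    exact ⟨⟨f y, Finset.mem_image_of_mem f hy⟩, hf (ha _) hy (a _).2⟩

variable (f n) in
/-- A section over an `n`-element set is determined by its set of values. -/
def equivFinset : SymSections f n ≃ {T : Finset Y // T.card = n ∧ Set.InjOn f (T : Set Y)} :=
  Equiv.ofBijective (fun p => ⟨p.values, p.card_values, p.injOn_values⟩)
    ⟨fun _ _ h => values_injective (congrArg Subtype.val h), fun ⟨_, hT, hf⟩ => by
      obtain ⟨p, hp⟩ := exists_values_eq hT hf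
      exact ⟨p, Subtype.ext hp⟩⟩

/-- Turns the enumerations in `IsMotivicCoeff` into an equality of multisets. Since the values form
a set, a tuple with this multiset has no repetitions and hence comes from a bijection. -/
theorem exists_enumeration_iff {p : SymSections f n} {r : Fin n → Y} :
    (∃ x : Fin n ≃ p.1.1, ∀ i, (p.2 (x i)).1 = r i) ↔ Finset.univ.val.map r = p.values.val := by
  constructor
  · rintro ⟨x, hx⟩
    have e : r = (fun a => (p.2 a).1) ∘ x := funext fun i => (hx i).symm
    rw [e, ← Multiset.map_map, Multiset.map_univ_val_equiv]
    rfl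
  · intro h
    have hr : Function.Injective r := by
      intro i j hij
      exact Multiset.inj_on_of_nodup_map (h ▸ p.values.nodup) i (Finset.mem_univ_val i) j
        (Finset.mem_univ_val j) hij
    have hm : ∀ i, ∃ x, (p.2 x).1 = r i := fun i => by
      rw [← mem_values, ← Finset.mem_val, ← h]
      exact Multiset.mem_map_of_mem r (Finset.mem_univ_val i)
    choose x hx using hm
    have hxi : Function.Injective x := fun i j hij => hr (by rw [← hx, ← hx, hij])
    refine ⟨Equiv.ofBijective x ((Fintype.bijective_iff_injective_and_card x).2 ⟨hxi, ?_⟩), hx⟩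
    simp [p.1.2]

end SymSections

theorem exists_map_univ_eq {Y : Type*} {T : Finset Y} {n : ℕ} (hT : T.card = n) :
    ∃ r : Fin n → Y, Finset.univ.val.map r = T.val := by
  subst hT
  refine ⟨fun i => (T.equivFin.symm i).1, ?_⟩
  have : (fun i => (T.equivFin.symm i).1) = Subtype.val ∘ T.equivFin.symm := rfl
  rw [this, ← Multiset.map_map, Multiset.map_univ_val_equiv]
  exact Multiset.attach_map_val T.1

/-- With `injective_of_map_univ_eq`: the tuples enumerating an admissible set `T` are exactly those
with `f ∘ r` injective, a condition that is visibly definable. -/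
theorem exists_finset_of_injective {Y X : Type*} {f : Y → X} {n : ℕ} {r : Fin n → Y}
    (hr : Function.Injective (f ∘ r)) :
    ∃ T : {T : Finset Y // T.card = n ∧ Set.InjOn f (T : Set Y)},
      Finset.univ.val.map r = T.1.val := by
  refine ⟨⟨Finset.univ.map ⟨r, .of_comp hr⟩, by simp, ?_⟩, rfl⟩
  rw [Finset.coe_map, Finset.coe_univ, Set.image_univ]
  rintro _ ⟨i, rfl⟩ _ ⟨i', rfl⟩ h
  exact congrArg _ (hr h)

theorem injective_of_map_univ_eq {Y X : Type*} {f : Y → X} {n : ℕ}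
    (T : {T : Finset Y // T.card = n ∧ Set.InjOn f (T : Set Y)}) {r : Fin n → Y}
    (hr : Finset.univ.val.map r = T.1.val) : Function.Injective (f ∘ r) := by
  intro i j hij
  have hm : ∀ i, r i ∈ (T.1 : Set Y) := fun i => by
    rw [Finset.mem_coe, ← Finset.mem_val, ← hr]
    exact Multiset.mem_map_of_mem r (Finset.mem_univ_val i)
  exact Multiset.inj_on_of_nodup_map (hr ▸ T.1.nodup) i (Finset.mem_univ_val i) j
    (Finset.mem_univ_val j) (T.2.2 (hm i) (hm j) hij)

/-! ### Existence of the coefficients. -/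

variable {F Ω : Type u} [Field F] [Field Ω] [Algebra F Ω]

/-- Replaces dependent pairs by finite subsets of `Y`, on which automorphisms act by taking images.
-/
theorem isMotivicCoeff_iff {Y X : DefSet F Ω} (f : Y.carrier → X.carrier) (n : ℕ)
    (c : GrothendieckRing F Ω) : IsMotivicCoeff f n c ↔
      ∃ (B : DefSet F Ω)
        (κ : {T : Finset Y.carrier // T.card = n ∧ Set.InjOn f (T : Set Y.carrier)} ≃ B.carrier),
        IsDefinable F {w : (Fin n × Fin Y.dim) ⊕ Fin B.dim → Ω |
          ∃ T, ∃ r : Fin n → Y.carrier, Finset.univ.val.map r = T.1.val ∧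
            w = Sum.elim (fun ij => (r ij.1).1 ij.2) (κ T).1} ∧ c = B.cls := by
  have key : ∀ (B : DefSet F Ω) (κ : SymSections f n ≃ B.carrier),
      {w : (Fin n × Fin Y.dim) ⊕ Fin B.dim → Ω |
      ∃ (p : SymSections f n) (x : Fin n ≃ p.1.1),
        w = Sum.elim (fun ij => (p.2 (x ij.1)).1.1 ij.2) (κ p).1} =
      {w : (Fin n × Fin Y.dim) ⊕ Fin B.dim → Ω |
          ∃ T, ∃ r : Fin n → Y.carrier, Finset.univ.val.map r = T.1.val ∧
            w = Sum.elim (fun ij => (r ij.1).1 ij.2)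
              (((SymSections.equivFinset f n).symm.trans κ) T).1} := by
    intro B κ
    ext w
    constructor
    · rintro ⟨p, x, rfl⟩
      refine ⟨SymSections.equivFinset f n p, fun i => (p.2 (x i)).1,
        SymSections.exists_enumeration_iff.1 ⟨x, fun _ => rfl⟩, ?_⟩
      simp
    · rintro ⟨T, r, hr, rfl⟩
      obtain ⟨p, rfl⟩ := (SymSections.equivFinset f n).surjective T
      obtain ⟨x, hx⟩ := SymSections.exists_enumeration_iff.2 hr
      refine ⟨p, x, ?_⟩
      simp [hx]
  constructor
  · rintro ⟨B, κ, h, rfl⟩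
    exact ⟨B, (SymSections.equivFinset f n).symm.trans κ, key B κ ▸ h, rfl⟩
  · rintro ⟨B, κ, h, rfl⟩
    refine ⟨B, (SymSections.equivFinset f n).trans κ, ?_, rfl⟩
    rw [key]
    simpa [← Equiv.trans_assoc] using h

/-- The tuples with `f ∘ r` injective form a definable set. The symmetric encoding identifies two of
them exactly when they have the same underlying set, so its image parametrizes the sections. -/
theorem exists_isMotivicCoeff {Y X : DefSet F Ω} {f : Y.carrier → X.carrier}
    (hf : DefSet.IsDefinableMap f) (n : ℕ) : ∃ c, IsMotivicCoeff f n c := by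
  obtain ⟨N, P, hP⟩ := exists_symmetric_encoding F Ω n Y.dim
  let rows (r : Fin n → Y.carrier) : Fin n × Fin Y.dim → Ω := fun ij => (r ij.1).1 ij.2
  let enc (y : Fin n × Fin Y.dim → Ω) : Fin N → Ω := fun k => MvPolynomial.aeval y (P k)
  have henc : ∀ r r', enc (rows r) = enc (rows r') ↔
      (Finset.univ.val.map r : Multiset Y.carrier) = Finset.univ.val.map r' := by
    intro r r'
    rw [funext_iff]
    refine (hP (rows r) (rows r')).trans ?_
    have e : ∀ r, (Finset.univ.val.map fun i j => rows r (i, j)) =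
        (Finset.univ.val.map r).map Subtype.val := fun r => by
      rw [Multiset.map_map]; rfl
    rw [e, e, (Multiset.map_injective Subtype.val_injective).eq_iff]
  let good : Set (Fin n × Fin Y.dim → Ω) :=
    {y | ∃ r : Fin n → Y.carrier, Function.Injective (f ∘ r) ∧ y = rows r}
  have hgood : IsDefinable F good := by
    -- That `f` takes distinct values at two rows means that no `x` is paired with both rows in the
    -- graph of `f`.
    have e : good = {y | (∀ i, (fun j => y (i, j)) ∈ Y.carrier) ∧
        ∀ i i', ¬ (¬ i = i' ∧ ∃ x : Fin X.dim → Ω,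
          (Sum.elim (fun j => y (i, j)) x ∈
            {w : Fin Y.dim ⊕ Fin X.dim → Ω | ∃ a : Y.carrier, w = Sum.elim a.1 (f a).1}) ∧
          (Sum.elim (fun j => y (i', j)) x ∈
            {w : Fin Y.dim ⊕ Fin X.dim → Ω | ∃ a : Y.carrier, w = Sum.elim a.1 (f a).1}))} := by
      have hel : ∀ (a : Fin Y.dim → Ω) x, (Sum.elim a x ∈
          {w : Fin Y.dim ⊕ Fin X.dim → Ω | ∃ a : Y.carrier, w = Sum.elim a.1 (f a).1}) ↔
          ∃ h : a ∈ Y.carrier, x = (f ⟨a, h⟩).1 := by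
        intro a x
        constructor
        · rintro ⟨b, hb⟩
          rw [Sum.elim_eq_iff] at hb
          obtain ⟨rfl, rfl⟩ := hb
          exact ⟨b.2, rfl⟩
        · rintro ⟨h, rfl⟩
          exact ⟨⟨a, h⟩, rfl⟩
      ext y
      simp only [hel]
      constructor
      · rintro ⟨r, hr, rfl⟩
        refine ⟨fun i => (r i).2, ?_⟩
        rintro i i' ⟨hne, x, ⟨h1, rfl⟩, h2, h3⟩
        exact hne (hr (Subtype.ext h3))
      · rintro ⟨h1, h2⟩
        refine ⟨fun i => ⟨_, h1 i⟩, fun i i' h => ?_, rfl⟩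
        by_contra hne
        exact h2 i i' ⟨hne, _, ⟨h1 i, rfl⟩, h1 i', congrArg Subtype.val h⟩
    rw [e]
    refine .and (.forall_finite fun i => Y.definable.mem_comp _) (.forall_finite fun i =>
      .forall_finite fun i' => .not ?_)
    by_cases h : i = i'
    · simpa [h] using IsDefinable.empty
    · simp only [h, not_false_eq_true, true_and]
      refine .exists_vector (.and ?_ ?_)
      · convert IsDefinable.mem_comp hf (Sum.elim (fun j => Sum.inl (i, j)) (fun j => Sum.inr j))
          using 4
        ext j; cases j <;> rfl
      · convert IsDefinable.mem_comp hf (Sum.elim (fun j => Sum.inl (i', j)) (fun j => Sum.inr j))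
          using 4
        ext j; cases j <;> rfl
  have hgraph : IsDefinable F {w : (Fin n × Fin Y.dim) ⊕ Fin N → Ω |
      w ∘ Sum.inl ∈ good ∧ w ∘ Sum.inr = enc (w ∘ Sum.inl)} := by
    refine .and (hgood.mem_comp _) ?_
    simp only [funext_iff]
    refine .forall_finite fun k => ?_
    convert isDefinable_aeval_eq (Ω := Ω) (.X (Sum.inr k)) (MvPolynomial.rename Sum.inl (P k))
      using 4
    · simp
    · simp [enc, MvPolynomial.aeval_rename]
  let B : DefSet F Ω := ⟨N, {b | ∃ y, y ∈ good ∧ b = enc y}, by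
    refine .exists_vector ?_
    exact hgraph.mem_comp (Sum.elim Sum.inr Sum.inl)⟩
  have hex : ∀ T : {T : Finset Y.carrier // T.card = n ∧ Set.InjOn f (T : Set Y.carrier)},
      ∃ r : Fin n → Y.carrier, Finset.univ.val.map r = T.1.val :=
    fun T => exists_map_univ_eq T.2.1
  choose r hr using hex
  refine ⟨B.cls, (isMotivicCoeff_iff f n _).2 ⟨B, Equiv.ofBijective
    (fun T => ⟨enc (rows (r T)), rows (r T), ⟨r T, injective_of_map_univ_eq T (hr T), rfl⟩, rfl⟩)
    ⟨?_, ?_⟩, ?_, rfl⟩⟩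
  · intro T T' h
    have h1 := (henc _ _).1 (congrArg Subtype.val h)
    rw [hr, hr] at h1
    exact Subtype.ext (Finset.val_injective h1)
  · rintro ⟨_, _, ⟨r', hr', rfl⟩, rfl⟩
    obtain ⟨T, hT⟩ := exists_finset_of_injective hr'
    exact ⟨T, Subtype.ext ((henc _ _).2 ((hr T).trans hT.symm))⟩
  · convert hgraph using 1
    ext w
    constructor
    · rintro ⟨T, r', hr', rfl⟩
      exact ⟨⟨r', injective_of_map_univ_eq T hr', rfl⟩, (henc _ _).2 ((hr T).trans hr'.symm)⟩
    · rintro ⟨⟨r', hr', h1⟩, h2⟩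
      obtain ⟨T, hT⟩ := exists_finset_of_injective hr'
      refine ⟨T, r', hT, ?_⟩
      rw [← Sum.elim_comp_inl_inr w, h2, h1]
      congr 1
      exact (henc _ _).2 (hT.trans (hr T).symm)

/-! ### Coefficients of the motivic product count stable sets -/

section Stable

variable {F Ω : Type u} [Field F] [Field Ω] [Algebra F Ω]

/-- The action of an automorphism of `Ω` over `F` on a definable set. -/
def DefSet.perm (A : DefSet F Ω) (σ : Ω ≃ₐ[F] Ω) : Equiv.Perm A.carrier where
  toFun a := ⟨fun i => σ (a.1 i), A.definable.map_mem σ a.2⟩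
  invFun a := ⟨fun i => σ.symm (a.1 i), A.definable.map_mem σ.symm a.2⟩
  left_inv a := by simp
  right_inv a := by simp

/-- The graph of a definable map is a definable set, hence stable under automorphisms. -/
theorem DefSet.IsDefinableMap.perm_comm {A B : DefSet F Ω} {f : A.carrier → B.carrier}
    (hf : DefSet.IsDefinableMap f) (σ : Ω ≃ₐ[F] Ω) (a : A.carrier) :
    f (A.perm σ a) = B.perm σ (f a) := by
  obtain ⟨a', ha'⟩ := hf.map_mem σ ⟨a, rfl⟩
  have e1 : A.perm σ a = a' := Subtype.ext (funext fun i => congrFun ha' (Sum.inl i))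
  have e2 : B.perm σ (f a) = f a' := Subtype.ext (funext fun i => congrFun ha' (Sum.inr i))
  rw [e1, e2]

theorem DefSet.card_rationalPoints_eq_card_fixed (A : DefSet F Ω) {σ : Ω ≃ₐ[F] Ω}
    (hσ : ∀ y : Ω, σ y = y ↔ y ∈ Set.range (algebraMap F Ω)) :
    Nat.card A.rationalPoints = Nat.card {a : A.carrier // A.perm σ a = a} := by
  refine Nat.card_congr (Equiv.ofBijective
    (fun x => ⟨⟨fun i => algebraMap F Ω (x.1 i), x.2⟩,
      Subtype.ext (funext fun i => (hσ _).2 ⟨_, rfl⟩)⟩) ⟨?_, ?_⟩)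
  · intro x y hxy
    apply Subtype.ext
    funext i
    have := congrArg (fun c => c.1.1 i) hxy
    exact (algebraMap F Ω).injective this
  · rintro ⟨⟨c, hc⟩, h⟩
    have h' : ∀ i, c i ∈ Set.range (algebraMap F Ω) := fun i =>
      (hσ _).1 (congrFun (congrArg Subtype.val h) i)
    choose x hx using h'
    have hx' : (fun i => algebraMap F Ω (x i)) = c := funext hx
    exact ⟨⟨x, by rw [hx']; exact hc⟩, Subtype.ext (Subtype.ext hx')⟩

/-- Rational points of the coding set are fixed points of `σ`. The graph of the coding is definable,
so the coding carries the action on finite subsets to the action on codes. -/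
theorem IsMotivicCoeff.pointCount_eq [Finite F] [IsAlgClosed Ω] {Y X : DefSet F Ω}
    {f : Y.carrier → X.carrier} {n : ℕ} {c : GrothendieckRing F Ω}
    (h : IsMotivicCoeff f n c) {σ : Ω ≃ₐ[F] Ω}
    (hσ : ∀ y : Ω, σ y = y ↔ y ∈ Set.range (algebraMap F Ω)) :
    pointCount F Ω c = Nat.card {T : Finset Y.carrier // (T.card = n ∧
      Set.InjOn f (T : Set Y.carrier)) ∧ T.map (Y.perm σ).toEmbedding = T} := by
  obtain ⟨B, κ, hκ, rfl⟩ := (isMotivicCoeff_iff f n c).1 h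
  rw [pointCount_cls, B.card_rationalPoints_eq_card_fixed hσ]
  congr 1
  have key : ∀ T : {T : Finset Y.carrier // T.card = n ∧ Set.InjOn f (T : Set Y.carrier)},
      B.perm σ (κ T) = κ T ↔ T.1.map (Y.perm σ).toEmbedding = T.1 := by
    intro T
    obtain ⟨r, hr⟩ := exists_map_univ_eq T.2.1
    -- Applying `σ` to an enumeration of `T` together with its code gives an enumeration of some
    -- `T'` with its code, and `T'` has to be `σ T`.
    obtain ⟨T', r', hr', he⟩ := hκ.map_mem σ ⟨T, r, hr, rfl⟩
    have e1 : r' = Y.perm σ ∘ r :=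
      funext fun i => Subtype.ext (funext fun j => (congrFun he (Sum.inl (i, j))).symm)
    have e2 : B.perm σ (κ T) = κ T' := Subtype.ext (funext fun i => congrFun he (Sum.inr i))
    have e3 : T'.1 = T.1.map (Y.perm σ).toEmbedding := by
      apply Finset.val_injective
      rw [← hr', e1, ← Multiset.map_map, hr]
      rfl
    rw [e2, κ.injective.eq_iff, ← e3, Subtype.ext_iff]
  exact Nat.card_congr ((κ.subtypeEquiv fun T => (key T).symm).symm.trans
    (Equiv.subtypeSubtypeEquivSubtypeInter _ _))

end Stable

/-! ### Equivariant sections over finite sets and orbits -/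

section Orbits

open Function

variable {X Y C : Type*} {σ : Equiv.Perm X} {τ : Equiv.Perm Y} {f : Y → X} {x : C → X}

theorem map_iterate_of_semiconj (hf : ∀ y, f (τ y) = σ (f y)) (k : ℕ) (y : Y) :
    f (τ^[k] y) = σ^[k] (f y) := (Semiconj.iterate_right hf k) y

/-- After `k` steps, `k * (d - 1)` further steps complete `k` full turns. This gives a way back
along a finite orbit by forward iteration alone. -/
theorem iterate_mul_sub_one {α : Type*} {g : α → α} {a : α} {d : ℕ} (hd : 0 < d)
    (ha : g^[d] a = a) (k : ℕ) : g^[k * (d - 1)] (g^[k] a) = a := by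
  rw [← iterate_add_apply, ← Nat.mul_succ, Nat.succ_eq_add_one, Nat.sub_add_cancel hd]
  exact (IsPeriodicPt.const_mul (show IsPeriodicPt g d a from ha) k)

theorem iterate_mem_of_map_eq {T : Finset Y} (hT : T.map τ.toEmbedding = T) {y : Y} (hy : y ∈ T)
    (k : ℕ) : τ^[k] y ∈ T := by
  induction k with
  | zero => exact hy
  | succ k ih =>
    rw [iterate_succ_apply', ← hT]
    exact Finset.mem_map_of_mem _ ih

theorem finite_setOf_sum_deg_eq {deg : C → ℕ} (hfin : ∀ n, {v | deg v ≤ n}.Finite) (n : ℕ) :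
    {D : Finset C | ∑ v ∈ D, deg v = n}.Finite := by
  refine (hfin n).toFinset.powerset.finite_toSet.subset fun D hD => ?_
  simp only [Finset.coe_powerset, Set.Finite.coe_toFinset, Set.mem_preimage, Set.mem_powerset_iff]
  intro v hv
  rw [Set.mem_ofPred_eq] at hD ⊢
  rw [← hD]
  exact Finset.single_le_sum (f := deg) (fun _ _ => Nat.zero_le _) hv

/-- A finite set of indices, with a point of period dividing `deg v` over `x v` for every
index `v` in it. -/
abbrev OrbitSections (τ : Equiv.Perm Y) (f : Y → X) (deg : C → ℕ) (x : C → X) : Type _ :=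
  Σ D : Finset C, ∀ v : D, {y // f y = x v ∧ τ^[deg v] y = y}

variable [DecidableEq Y]

/-- The union of the orbits of the chosen points. -/
def orbitUnion (τ : Equiv.Perm Y) (deg : C → ℕ) (p : OrbitSections τ f deg x) : Finset Y :=
  p.1.attach.biUnion fun v => (Finset.range (deg v)).image fun k => τ^[k] (p.2 v).1

variable {deg : C → ℕ}

/-- The bound on the exponent may be dropped: the chosen point has period dividing `deg v`, so
exponents can be reduced modulo `deg v`. -/
theorem mem_orbitUnion {p : OrbitSections τ f deg x}
    (hpos : ∀ v, 0 < deg v) {y : Y} :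
    y ∈ orbitUnion τ deg p ↔ ∃ v k, τ^[k] (p.2 v).1 = y := by
  simp only [orbitUnion, Finset.mem_biUnion, Finset.mem_attach, true_and, Finset.mem_image,
    Finset.mem_range]
  refine exists_congr fun v => ⟨fun ⟨k, _, h⟩ => ⟨k, h⟩, ?_⟩
  rintro ⟨k, rfl⟩
  exact ⟨k % deg v, Nat.mod_lt _ (hpos _),
    IsPeriodicPt.iterate_mod_apply (show IsPeriodicPt τ _ _ from (p.2 v).2.2) k⟩

variable (hf : ∀ y, f (τ y) = σ (f y)) (hdeg : ∀ v, minimalPeriod σ (x v) = deg v)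
  (hpos : ∀ v, 0 < deg v) (hx : ∀ z ∈ periodicPts σ, ∃ v k, σ^[k] (x v) = z)
  (hinj : ∀ v w k, σ^[k] (x v) = x w → v = w)

include hdeg in
theorem iterate_deg (v : C) : σ^[deg v] (x v) = x v := by
  rw [← hdeg]; exact iterate_minimalPeriod

include hdeg hpos hinj in
-- By `hx` and `hinj`, the base points `x v` meet each finite orbit exactly once. Here `hinj` is
-- extended from base points to arbitrary points of the orbits, by moving on from `σ^[l] (x w)` to
-- `x w`.
theorem orbit_index_unique {v w : C} {k l : ℕ} (h : σ^[k] (x v) = σ^[l] (x w)) : v = w := by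
  refine hinj v w (l * (deg w - 1) + k) ?_
  rw [iterate_add_apply, h, iterate_mul_sub_one (hpos w) (iterate_deg hdeg w)]

include hf hdeg hpos hinj in
-- Points of different chosen orbits lie over different orbits of `σ`. Within one orbit, the
-- exponents are below the minimal period of `x v`, so the images are already distinct.
theorem orbitUnion_injOn (p : OrbitSections τ f deg x) :
    Set.InjOn f (orbitUnion τ deg p : Set Y) := by
  intro y hy y' hy' h
  simp only [orbitUnion, Finset.coe_biUnion, Set.mem_iUnion, Finset.coe_image, Set.mem_image,
    Finset.mem_coe, Finset.mem_range] at hy hy'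
  obtain ⟨v, -, k, hk, rfl⟩ := hy
  obtain ⟨w, -, l, hl, rfl⟩ := hy'
  rw [map_iterate_of_semiconj hf, map_iterate_of_semiconj hf, (p.2 v).2.1, (p.2 w).2.1] at h
  obtain rfl : v = w := Subtype.ext (orbit_index_unique hdeg hpos hinj h)
  rw [← hdeg] at hk hl
  rw [iterate_injOn_Iio_minimalPeriod hk hl h]

include hf hdeg hpos hinj in
theorem card_orbitUnion (p : OrbitSections τ f deg x) :
    (orbitUnion τ deg p).card = ∑ v ∈ p.1, deg v := by
  rw [orbitUnion, Finset.card_biUnion, ← Finset.sum_attach p.1 deg]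
  · refine Finset.sum_congr rfl fun v _ => ?_
    rw [Finset.card_image_of_injOn, Finset.card_range]
    intro k hk l hl h
    have h' := congrArg f h
    simp only [map_iterate_of_semiconj hf, (p.2 v).2.1] at h'
    simp only [Finset.coe_range, ← hdeg] at hk hl
    exact iterate_injOn_Iio_minimalPeriod hk hl h'
  · intro v _ w _ hvw
    refine Finset.disjoint_left.2 fun y hy hy' => ?_
    obtain ⟨k, -, rfl⟩ := Finset.mem_image.1 hy
    obtain ⟨l, -, h⟩ := Finset.mem_image.1 hy'
    refine hvw (Subtype.ext (orbit_index_unique hdeg hpos hinj (k := k) (l := l) ?_))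
    rw [← (p.2 v).2.1, ← (p.2 w).2.1, ← map_iterate_of_semiconj hf, ← map_iterate_of_semiconj hf, h]

include hpos in
theorem map_orbitUnion (p : OrbitSections τ f deg x) :
    (orbitUnion τ deg p).map τ.toEmbedding = orbitUnion τ deg p := by
  refine Finset.eq_of_subset_of_card_le ?_ (by simp)
  intro y hy
  obtain ⟨z, hz, rfl⟩ := Finset.mem_map.1 hy
  obtain ⟨v, k, rfl⟩ := (mem_orbitUnion hpos).1 hz
  exact (mem_orbitUnion hpos).2 ⟨v, k + 1, iterate_succ_apply' _ _ _⟩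

include hf hdeg hpos hinj in
-- An index `v` is used exactly when the union has a point above `x v`, and that point is unique by
-- `orbitUnion_injOn`.
theorem orbitUnion_injective : Function.Injective (orbitUnion τ deg :
    OrbitSections τ f deg x → Finset Y) := by
  have key : ∀ p p' : OrbitSections τ f deg x,
      orbitUnion τ deg p = orbitUnion τ deg p' → p.1 ⊆ p'.1 := by
    intro p p' h v hv
    have h1 := (mem_orbitUnion hpos).2 ⟨⟨v, hv⟩, 0, rfl⟩
    rw [h] at h1
    obtain ⟨w, k, hk⟩ := (mem_orbitUnion hpos).1 h1
    have h2 := congrArg f hk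
    rw [map_iterate_of_semiconj hf, (p'.2 w).2.1, iterate_zero_apply, (p.2 _).2.1] at h2
    have h3 : w.1 = v := hinj _ _ _ h2
    exact h3 ▸ w.2
  intro p p' h
  have hD := (key p p' h).antisymm (key p' p h.symm)
  obtain ⟨D, a⟩ := p
  obtain ⟨D', a'⟩ := p'
  obtain rfl : D = D' := hD
  congr 1
  funext v
  have h1 := (mem_orbitUnion hpos (p := ⟨D, a⟩)).2 ⟨v, 0, rfl⟩
  have h2 := (mem_orbitUnion hpos (p := ⟨D, a'⟩)).2 ⟨v, 0, rfl⟩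
  rw [← h] at h2
  refine Subtype.ext (orbitUnion_injOn hf hdeg hpos hinj _ h1 h2 ?_)
  exact (a v).2.1.trans (a' v).2.1.symm

include hf hdeg hpos hinj hx in
-- Take for `D` the indices `v` with `x v ∈ f(T)`, and choose the point of `T` above each `x v`.
-- Every point of `T` is periodic, so its image lies on the orbit of some `x v`.
theorem exists_orbitUnion_eq {T : Finset Y} (hfT : Set.InjOn f (T : Set Y))
    (hT : T.map τ.toEmbedding = T) :
    ∃ p : OrbitSections τ f deg x, orbitUnion τ deg p = T := by
  classical
  have hxi : Function.Injective x := fun v w h => hinj v w 0 h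
  let D : Finset C := (T.image f).preimage x hxi.injOn
  have hex : ∀ v : D, ∃ a : {y // f y = x v ∧ τ^[deg v] y = y}, a.1 ∈ T := by
    rintro ⟨v, hv⟩
    obtain ⟨y, hy, hyv⟩ := Finset.mem_image.1 (Finset.mem_preimage.1 hv)
    -- `τ^[deg v] y` lies in `T` over the same point as `y`, so injectivity of `f` on `T` makes them
    -- equal.
    refine ⟨⟨y, hyv, hfT (iterate_mem_of_map_eq hT hy _) hy ?_⟩, hy⟩
    rw [map_iterate_of_semiconj hf, hyv, iterate_deg hdeg]
  choose a ha using hex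
  refine ⟨⟨D, a⟩, ?_⟩
  ext y
  rw [mem_orbitUnion hpos]
  constructor
  · rintro ⟨v, k, rfl⟩
    exact iterate_mem_of_map_eq hT (ha v) k
  · intro hy
    have hper : y ∈ periodicPts τ := by
      -- By finiteness of `T`, two iterates of `y` coincide; cancelling the injective `τ^[k]` makes
      -- `y` periodic.
      have hni : ¬ Function.Injective fun k : ℕ => (⟨τ^[k] y, iterate_mem_of_map_eq hT hy k⟩ : T) :=
        not_injective_infinite_finite _
      rw [Function.Injective] at hni
      push Not at hni
      obtain ⟨k, l, hkl, hne⟩ := hni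
      have hkl' : τ^[k] y = τ^[l] y := congrArg Subtype.val hkl
      wlog hlt : k < l generalizing k l
      · exact this l k hkl.symm hne.symm hkl'.symm (by omega)
      refine ⟨l - k, by omega, τ.injective.iterate k ?_⟩
      rw [← iterate_add_apply, Nat.add_sub_cancel' hlt.le, hkl']
    obtain ⟨m, hm, hmy⟩ := hper
    obtain ⟨v, k, hk⟩ := hx (f y) ⟨m, hm, by
      have := congrArg f hmy
      rwa [map_iterate_of_semiconj hf] at this⟩
    -- Moving `y` on along its orbit gives a point of `T` above the base point, which shows `v ∈ D`.
    have h1 : f (τ^[k * (deg v - 1)] y) = x v := by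
      rw [map_iterate_of_semiconj hf, ← hk, iterate_mul_sub_one (hpos v) (iterate_deg hdeg v)]
    have hv : v ∈ D := Finset.mem_preimage.2
      (Finset.mem_image.2 ⟨_, iterate_mem_of_map_eq hT hy _, h1⟩)
    refine ⟨⟨v, hv⟩, k, hfT (iterate_mem_of_map_eq hT (ha _) k) hy ?_⟩
    rw [map_iterate_of_semiconj hf, (a ⟨v, hv⟩).2.1, hk]

include hf hdeg hpos hinj hx in
/-- Stable sets of cardinality `n` on which `f` is injective are counted by sets of orbits. -/
theorem card_stable_eq_sum (n : ℕ) (hfin : {D : Finset C | ∑ v ∈ D, deg v = n}.Finite)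
    (hA : ∀ v, Finite {y // f y = x v ∧ τ^[deg v] y = y}) :
    Nat.card {T : Finset Y // (T.card = n ∧ Set.InjOn f (T : Set Y)) ∧ T.map τ.toEmbedding = T} =
      ∑ D ∈ hfin.toFinset, ∏ v ∈ D, Nat.card {y // f y = x v ∧ τ^[deg v] y = y} := by
  let A (D : Finset C) := ∀ v : D, {y // f y = x v ∧ τ^[deg v] y = y}
  have e : (Σ D : {D : Finset C // ∑ v ∈ D, deg v = n}, A D.1) ≃
      {T : Finset Y // (T.card = n ∧ Set.InjOn f (T : Set Y)) ∧ T.map τ.toEmbedding = T} := by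
    refine Equiv.ofBijective (fun p => ⟨orbitUnion τ deg ⟨p.1.1, p.2⟩,
      ⟨(card_orbitUnion hf hdeg hpos hinj _).trans p.1.2, orbitUnion_injOn hf hdeg hpos hinj _⟩,
      map_orbitUnion hpos _⟩) ⟨?_, ?_⟩
    · rintro ⟨⟨D, hD⟩, a⟩ ⟨⟨D', hD'⟩, a'⟩ h
      have := orbitUnion_injective hf hdeg hpos hinj (congrArg Subtype.val h)
      cases this
      rfl
    · rintro ⟨T, ⟨hn, hfT⟩, hT⟩
      obtain ⟨⟨D, a⟩, rfl⟩ := exists_orbitUnion_eq hf hdeg hpos hx hinj hfT hT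
      exact ⟨⟨⟨D, (card_orbitUnion hf hdeg hpos hinj _).symm.trans hn⟩, a⟩, rfl⟩
  rw [← Nat.card_congr e]
  have : Fintype {D : Finset C // ∑ v ∈ D, deg v = n} := hfin.fintype
  rw [Nat.card_sigma, ← Finset.sum_subtype (s := hfin.toFinset) (f := fun D => Nat.card (A D))
    (by simp)]
  refine Finset.sum_congr rfl fun D _ => ?_
  rw [Nat.card_pi, Finset.prod_coe_sort D
    (fun v => Nat.card {y // f y = x v ∧ τ^[deg v] y = y})]

end Orbits

/-! ### Infinite products and their expansions -/

section Expansion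

variable {C : Type*} {deg : C → ℕ} (a : C → ℕ)

theorem coeff_prod_one_add_C_mul_X_pow {R : Type*} [CommRing R] (a : C → R) (S : Finset C) (N : ℕ) :
    PowerSeries.coeff N (∏ v ∈ S, (1 + PowerSeries.C (a v) *
      (PowerSeries.X : PowerSeries R) ^ deg v)) =
      ∑ D ∈ S.powerset with ∑ v ∈ D, deg v = N, ∏ v ∈ D, a v := by
  rw [Finset.prod_one_add, map_sum, Finset.sum_filter]
  refine Finset.sum_congr rfl fun D _ => ?_
  rw [Finset.prod_mul_distrib, Finset.prod_pow_eq_pow_sum, ← map_prod, PowerSeries.coeff_C_mul,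
    PowerSeries.coeff_X_pow, mul_ite, mul_one, mul_zero]
  simp only [eq_comm]

theorem exists_forall_coeff_prod_eq (hfin : ∀ n, {v | deg v ≤ n}.Finite) (N : ℕ) :
    ∃ S₀ : Finset C, ∀ S : Finset C, S₀ ⊆ S →
      PowerSeries.coeff N (∏ v ∈ S, (1 + PowerSeries.C (a v : ℂ) *
        (PowerSeries.X : PowerSeries ℂ) ^ deg v)) =
      ((∑ D ∈ (finite_setOf_sum_deg_eq hfin N).toFinset, ∏ v ∈ D, a v : ℕ) : ℂ) := by
  -- A set of total degree `N` contains only indices of degree at most `N`, so larger `S` contribute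
  -- nothing new.
  refine ⟨(hfin N).toFinset, fun S hS => ?_⟩
  rw [coeff_prod_one_add_C_mul_X_pow]
  push_cast
  refine Finset.sum_congr ?_ fun _ _ => rfl
  ext D
  simp only [Finset.mem_filter, Finset.mem_powerset, Set.Finite.mem_toFinset, Set.mem_ofPred_eq,
    and_iff_right_iff_imp]
  intro hD v hv
  refine hS ((Set.Finite.mem_toFinset _).2 ?_)
  rw [Set.mem_ofPred_eq, ← hD]
  exact Finset.single_le_sum (f := deg) (fun _ _ => Nat.zero_le _) hv

/-- Absolute convergence allows the terms to be regrouped along the finite fibres of `d`. -/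
theorem summable_and_hasSum_fiberwise {ι : Type*} {t : ι → ℂ} {d : ι → ℕ} {r : ℂ}
    (hd : ∀ n, {i | d i = n}.Finite) (hs : Summable fun i => ‖t i‖) (hr : HasSum t r) :
    (Summable fun n => ‖∑ i ∈ (hd n).toFinset, t i‖) ∧
      HasSum (fun n => ∑ i ∈ (hd n).toFinset, t i) r := by
  have hF : ∀ n, Fintype {i // d i = n} := fun n => (hd n).fintype
  have hfib : ∀ n, ∑ i : {i // d i = n}, t i.1 = ∑ i ∈ (hd n).toFinset, t i := fun n =>
    (Finset.sum_subtype _ (by simp) _).symm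
  have hs' : Summable fun p : Σ n, {i // d i = n} => ‖t p.2.1‖ :=
    (Equiv.sigmaFiberEquiv d).summable_iff.2 hs
  have hr' : HasSum (fun p : Σ n, {i // d i = n} => t p.2.1) r :=
    (Equiv.sigmaFiberEquiv d).hasSum_iff.2 hr
  constructor
  · refine Summable.of_nonneg_of_le (fun _ => norm_nonneg _) (fun n => ?_) hs'.sigma
    rw [← hfib, tsum_fintype]
    exact norm_sum_le _ _
  · have := hr'.sigma fun n => hasSum_fintype _
    simpa only [hfib] using this

theorem summable_and_hasSum_of_hasProd (hfin : ∀ n, {v | deg v ≤ n}.Finite) {z r : ℂ}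
    (hs : Summable fun v => ‖(a v : ℂ) * z ^ deg v‖)
    (hr : HasProd (fun v => 1 + (a v : ℂ) * z ^ deg v) r) :
    (Summable fun n : ℕ =>
      ‖((∑ D ∈ (finite_setOf_sum_deg_eq hfin n).toFinset, ∏ v ∈ D, a v : ℕ) : ℂ) * z ^ n‖) ∧
    HasSum (fun n : ℕ =>
      ((∑ D ∈ (finite_setOf_sum_deg_eq hfin n).toFinset, ∏ v ∈ D, a v : ℕ) : ℂ) * z ^ n) r := by
  let t (D : Finset C) : ℂ := ∏ v ∈ D, ((a v : ℂ) * z ^ deg v)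
  have ht : Summable fun D => ‖t D‖ := by
    have := summable_finsetProd_of_summable_nonneg (fun v => norm_nonneg ((a v : ℂ) * z ^ deg v)) hs
    simpa only [t, norm_prod] using this
  have hsum : HasSum t r := by
    -- The product expands into the absolutely convergent sum of `t` over finite subsets; `hr`
    -- serves to identify its value with `r`.
    have h1 := tprod_one_add (f := fun v => (a v : ℂ) * z ^ deg v) ht.of_norm
    rw [hr.tprod_eq] at h1
    rw [h1]
    exact ht.of_norm.hasSum
  have hterm : ∀ n, ∑ D ∈ (finite_setOf_sum_deg_eq hfin n).toFinset, t D =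
      ((∑ D ∈ (finite_setOf_sum_deg_eq hfin n).toFinset, ∏ v ∈ D, a v : ℕ) : ℂ) * z ^ n := by
    intro n
    push_cast
    rw [Finset.sum_mul]
    refine Finset.sum_congr rfl fun D hD => ?_
    rw [Set.Finite.mem_toFinset, Set.mem_ofPred_eq] at hD
    simp only [t]
    rw [Finset.prod_mul_distrib, Finset.prod_pow_eq_pow_sum, hD]
  simp only [← hterm]
  exact summable_and_hasSum_fiberwise (finite_setOf_sum_deg_eq hfin) ht hsum

/-- Complex powers are multiplicative on natural number bases, so no choice of branch interferes. -/
theorem natCast_pow_cpow (q d : ℕ) (s : ℂ) : ((q ^ d : ℕ) : ℂ) ^ s = ((q : ℂ) ^ s) ^ d := by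
  induction d with
  | zero => simp
  | succ d ih => rw [pow_succ, Nat.cast_mul, Complex.natCast_mul_natCast_cpow, ih, pow_succ]

end Expansion

/-! ### Frobenius and finite subfields -/

section FiniteFields

open Polynomial in
theorem finite_setOf_pow_eq_self (L : Type*) [Field L] {n : ℕ} (hn : 1 < n) :
    {z : L | z ^ n = z}.Finite ∧ {z : L | z ^ n = z}.ncard ≤ n := by
  classical
  have hne : (X ^ n - X : L[X]) ≠ 0 := FiniteField.X_pow_card_sub_X_ne_zero L hn
  have e : {z : L | z ^ n = z} = ((X ^ n - X : L[X]).roots.toFinset : Set L) := by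
    ext z
    simp [hne, sub_eq_zero]
  rw [e]
  refine ⟨Finset.finite_toSet _, ?_⟩
  rw [Set.ncard_coe_finset]
  refine (Multiset.toFinset_card_le _).trans ((card_roots' _).trans ?_)
  rw [FiniteField.X_pow_card_sub_X_natDegree_eq L hn]

theorem finite_and_card_le_of_pow_eq_self {K : Type*} [Field K] {n : ℕ} (hn : 1 < n)
    (h : ∀ z : K, z ^ n = z) : Finite K ∧ Nat.card K ≤ n := by
  have e : {z : K | z ^ n = z} = Set.univ := Set.eq_univ_of_forall h
  have := finite_setOf_pow_eq_self K hn
  rw [e, Set.ncard_univ] at this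
  exact ⟨Set.finite_univ_iff.1 this.1, this.2⟩

/-- The image of `φ` already supplies `|K|` solutions of `z ^ |K| = z`, and there cannot be more. -/
theorem pow_natCard_eq_self_iff {K L : Type*} [Field K] [Finite K] [Field L] (φ : K →+* L)
    {z : L} : z ^ Nat.card K = z ↔ z ∈ Set.range φ := by
  have hK : 1 < Nat.card K := Finite.one_lt_card
  obtain ⟨h1, h2⟩ := finite_setOf_pow_eq_self L hK
  have hsub : Set.range φ ⊆ {z : L | z ^ Nat.card K = z} := by
    rintro _ ⟨a, rfl⟩
    have := Fintype.ofFinite K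
    rw [Set.mem_ofPred_eq, ← map_pow, Nat.card_eq_fintype_card, FiniteField.pow_card]
  have := Set.eq_of_subset_of_ncard_le hsub (by
    rwa [Set.ncard_range_of_injective φ.injective]) h1
  rw [this, Set.mem_ofPred_eq]

/-- Beyond the fixed field, the explicit power formula is needed to find the fixed points of the
iterates and to compare embeddings of residue fields. -/
theorem exists_frobenius (F Ω : Type*) [Field F] [Finite F] [Field Ω] [Algebra F Ω]
    [IsAlgClosed Ω] : ∃ σ : Ω ≃ₐ[F] Ω, ∀ z, σ z = z ^ Nat.card F := by
  have := Fintype.ofFinite F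
  obtain ⟨p, hp⟩ := CharP.exists F
  have : Fact p.Prime := ⟨CharP.char_is_prime F p⟩
  have : CharP Ω p := charP_of_injective_algebraMap (algebraMap F Ω).injective p
  have : ExpChar Ω p := ExpChar.prime Fact.out
  refine ⟨FiniteField.frobeniusAlgEquiv F Ω p, fun y => ?_⟩
  rw [FiniteField.frobeniusAlgEquiv_apply, Nat.card_eq_fintype_card]

/-- The composites of `φ` with the first `[K : F]` powers of Frobenius are distinct, and there are
at most `[K : F]` embeddings over `F`. Thus `ψ` is one of them. -/
theorem exists_pow_eq_of_algHom {F K Ω : Type*} [Field F] [Finite F] [Field K] [Finite K]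
    [Algebra F K] [Field Ω] [Algebra F Ω] (φ ψ : K →ₐ[F] Ω) :
    ∃ k, ∀ z, ψ z = φ z ^ (Nat.card F ^ k) := by
  have := Fintype.ofFinite F
  let Φ : Fin (Module.finrank F K) → (K →ₐ[F] Ω) := fun k =>
    φ.comp (FiniteField.frobeniusAlgHom F K ^ k.1)
  have hinj : Function.Injective Φ := by
    intro k l h
    refine (FiniteField.bijective_frobeniusAlgHom_pow F K).1 (AlgHom.ext fun z => ?_)
    exact φ.injective (DFunLike.congr_fun h z)
  have hbij := hinj.bijective_of_nat_card_le
    ((card_algHom_le_finrank F K Ω).trans_eq (by simp))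
  obtain ⟨k, hk⟩ := hbij.2 ψ
  refine ⟨k, fun z => ?_⟩
  rw [← hk, ← map_pow]
  simp only [Φ, AlgHom.comp_apply, AlgHom.coe_pow, FiniteField.coe_frobeniusAlgHom, pow_iterate,
    Nat.card_eq_fintype_card]

theorem iterate_pow_natCard {F Ω : Type*} [Field F] [Field Ω] [Algebra F Ω] {σ : Ω ≃ₐ[F] Ω}
    (hσ : ∀ z, σ z = z ^ Nat.card F) (k : ℕ) (z : Ω) : σ^[k] z = z ^ (Nat.card F ^ k) := by
  have : (σ : Ω → Ω) = (· ^ Nat.card F) := funext hσ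
  rw [this, pow_iterate]

end FiniteFields

/-! ### Frobenius on definable sets. -/

section Perm

variable {F Ω : Type u} [Field F] [Field Ω] [Algebra F Ω]

theorem DefSet.perm_iterate_apply_coe (A : DefSet F Ω) (σ : Ω ≃ₐ[F] Ω) (k : ℕ) (a : A.carrier)
    (i : Fin A.dim) : ((A.perm σ)^[k] a).1 i = σ^[k] (a.1 i) := by
  induction k with
  | zero => rfl
  | succ k ih => rw [Function.iterate_succ_apply', Function.iterate_succ_apply', ← ih]; rfl

/-- Each coordinate of a fixed point is one of the finitely many roots of `z ^ (q ^ k) = z`;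
positivity of `k` makes this equation nontrivial. -/
theorem DefSet.finite_setOf_perm_iterate_eq [Finite F] (A : DefSet F Ω) {σ : Ω ≃ₐ[F] Ω}
    (hσ : ∀ z, σ z = z ^ Nat.card F) {k : ℕ} (hk : 0 < k) :
    {a : A.carrier | (A.perm σ)^[k] a = a}.Finite := by
  have h1 : 1 < Nat.card F ^ k := Nat.one_lt_pow hk.ne' Finite.one_lt_card
  have h2 : (Set.pi Set.univ fun _ : Fin A.dim => {z : Ω | z ^ (Nat.card F ^ k) = z}).Finite :=
    Set.Finite.pi fun _ => (finite_setOf_pow_eq_self Ω h1).1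
  refine (h2.preimage Subtype.val_injective.injOn).subset fun a ha i _ => ?_
  rw [Set.mem_ofPred_eq, ← iterate_pow_natCard hσ, ← A.perm_iterate_apply_coe, ha]

end Perm

/-! ### The Galois action on geometric points -/

section GeomPoints

variable {F Ω : Type u} [Field F] [Field Ω] [Algebra F Ω] {X U : Scheme.{u}}

theorem evalAt_specMap_comp {V : Scheme.{u}} (σ : Ω →+* Ω) (y : Spec (.of Ω) ⟶ V) (f : Γ(V, ⊤)) :
    evalAt (Spec.map (CommRingCat.ofHom σ) ≫ y) f = σ (evalAt y f) := by
  have := congrArg (fun φ => φ.hom (y.appTop f))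
    (Scheme.ΓSpecIso_naturality (CommRingCat.ofHom σ))
  unfold evalAt
  rw [Scheme.Hom.comp_appTop]
  exact this

theorem eq_of_evalAt_eq {V : Scheme.{u}} [IsAffine V] {y z : Spec (.of Ω) ⟶ V}
    (h : ∀ f, evalAt y f = evalAt z f) : y = z := by
  refine ext_of_isAffine (CommRingCat.hom_ext (RingHom.ext fun f => ?_))
  have h1 := h f
  unfold evalAt at h1
  exact (ConcreteCategory.bijective_of_isIso (Scheme.ΓSpecIso (.of Ω)).hom).1 h1

/-- The action of an automorphism of `Ω` over `F` on `X(Ω)`. -/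
def GeomPoint.conj (π : X ⟶ Spec (.of F)) (σ : Ω ≃ₐ[F] Ω) (y : GeomPoint Ω π) : GeomPoint Ω π :=
  ⟨Spec.map (CommRingCat.ofHom (σ : Ω →+* Ω)) ≫ y.1, by
    rw [Category.assoc, y.2, ← Spec.map_comp, ← CommRingCat.ofHom_comp]
    congr 2
    ext a
    exact σ.commutes a⟩

theorem exists_lift_of_mem {V : X.Opens} (y : Spec (.of Ω) ⟶ X)
    (h : y (IsLocalRing.closedPoint Ω) ∈ V) : ∃ z : Spec (.of Ω) ⟶ V, z ≫ V.ι = y := by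
  refine ⟨IsOpenImmersion.lift V.ι y ?_, IsOpenImmersion.lift_fac _ _ _⟩
  rintro _ ⟨a, rfl⟩
  rw [Scheme.Opens.range_ι]
  have : a = IsLocalRing.closedPoint Ω := Subsingleton.elim (α := PrimeSpectrum Ω) _ _
  rwa [this]

theorem exists_affine_lift (y : Spec (.of Ω) ⟶ X) :
    ∃ (V : X.Opens) (_ : IsAffineOpen V) (z : Spec (.of Ω) ⟶ V), z ≫ V.ι = y := by
  obtain ⟨V, hV, hy, -⟩ := exists_isAffineOpen_mem_and_subset
    (x := y (IsLocalRing.closedPoint Ω)) (U := ⊤) trivial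
  obtain ⟨z, hz⟩ := exists_lift_of_mem (V := V) y hy
  exact ⟨V, hV, z, hz⟩

/-- A point of an affine open is determined by the values of functions there. For each `f`,
stability of the graph under `σ` yields a point with value `σ (f z)` at `f` and with the conjugate
coordinates. As `e` is injective, this point does not depend on `f`, so it is the conjugate of `z`.
-/
theorem IsRealization.conj {π : X ⟶ Spec (.of F)} {S : DefSet F Ω}
    {e : GeomPoint Ω π ≃ S.carrier} (he : IsRealization π S e) (σ : Ω ≃ₐ[F] Ω)
    (y : GeomPoint Ω π) : e (y.conj π σ) = S.perm σ (e y) := by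
  obtain ⟨y, hy⟩ := y
  obtain ⟨V, hV, z, rfl⟩ := exists_affine_lift y
  have : IsAffine V := hV
  have key : ∀ f : Γ(V, ⊤), ∃ (z' : Spec (.of Ω) ⟶ V)
      (hz' : (z' ≫ V.ι) ≫ π = Spec.map (CommRingCat.ofHom (algebraMap F Ω))),
      evalAt z' f = σ (evalAt z f) ∧ e ⟨z' ≫ V.ι, hz'⟩ = S.perm σ (e ⟨z ≫ V.ι, hy⟩) := by
    intro f
    obtain ⟨z', hz', h⟩ := (he V f).map_mem σ ⟨z, hy, rfl⟩
    exact ⟨z', hz', (congrFun h (Sum.inl ())).symm,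
      Subtype.ext (funext fun i => (congrFun h (Sum.inr i)).symm)⟩
  obtain ⟨z', hz', -, h'⟩ := key 0
  have hz : z' = Spec.map (CommRingCat.ofHom (σ : Ω →+* Ω)) ≫ z := by
    refine eq_of_evalAt_eq fun f => ?_
    rw [evalAt_specMap_comp]
    obtain ⟨z'', hz'', hf, h''⟩ := key f
    have := congrArg Subtype.val (e.injective (h''.trans h'.symm))
    rw [cancel_mono] at this
    rw [← this, hf]
    rfl
  rw [← h']
  congr 1
  apply Subtype.ext
  simp [GeomPoint.conj, hz]

theorem GeomPoint.conj_iterate_coe (π : X ⟶ Spec (.of F)) (σ : Ω ≃ₐ[F] Ω) (k : ℕ)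
    (y : GeomPoint Ω π) : ((GeomPoint.conj π σ)^[k] y).1 =
      Spec.map (CommRingCat.ofHom ((σ ^ k : Ω ≃ₐ[F] Ω) : Ω →+* Ω)) ≫ y.1 := by
  induction k with
  | zero =>
    have : CommRingCat.ofHom ((σ ^ 0 : Ω ≃ₐ[F] Ω) : Ω →+* Ω) = 𝟙 (CommRingCat.of Ω) := rfl
    rw [this, Spec.map_id, Category.id_comp]; rfl
  | succ k ih =>
    rw [Function.iterate_succ_apply']
    change Spec.map (CommRingCat.ofHom (σ : Ω →+* Ω)) ≫ ((GeomPoint.conj π σ)^[k] y).1 = _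
    rw [ih, ← Category.assoc, ← Spec.map_comp, ← CommRingCat.ofHom_comp, pow_succ']
    rfl

/-- The `Ω`-point with image `v` defined by an embedding of the residue field. -/
def pointOf (v : X) (φ : X.residueField v →+* Ω) : Spec (.of Ω) ⟶ X :=
  Spec.map (CommRingCat.ofHom φ) ≫ X.fromSpecResidueField v

theorem specMap_comp_pointOf (v : X) (φ : X.residueField v →+* Ω) (σ : Ω →+* Ω) :
    Spec.map (CommRingCat.ofHom σ) ≫ pointOf v φ = pointOf v (σ.comp φ) := by
  rw [pointOf, pointOf, ← Category.assoc, ← Spec.map_comp]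
  rfl

theorem exists_eq_pointOf (y : Spec (.of Ω) ⟶ X) : ∃ v φ, y = pointOf v φ :=
  ⟨_, _, ((Scheme.SpecToEquivOfField Ω X).symm_apply_apply y).symm⟩

theorem pointOf_closedPoint (v : X) (φ : X.residueField v →+* Ω) :
    pointOf v φ (IsLocalRing.closedPoint Ω) = v := by
  exact X.fromSpecResidueField_apply v _

theorem pointOf_index_injective {v w : X} {φ : X.residueField v →+* Ω}
    {ψ : X.residueField w →+* Ω} (h : pointOf v φ = pointOf w ψ) : v = w := by
  rw [← pointOf_closedPoint v φ, h, pointOf_closedPoint]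

theorem pointOf_injective (v : X) :
    Function.Injective (pointOf v : (X.residueField v →+* Ω) → (Spec (.of Ω) ⟶ X)) := by
  intro φ ψ h
  rw [pointOf, pointOf, cancel_mono] at h
  exact congrArg CommRingCat.Hom.hom (Spec.map_injective h)

/-- The structure map of the residue field of an `F`-scheme. -/
def residueStructMap (π : X ⟶ Spec (.of F)) (v : X) : F →+* X.residueField v :=
  (Spec.preimage (X.fromSpecResidueField v ≫ π)).hom

theorem specMap_residueStructMap (π : X ⟶ Spec (.of F)) (v : X) :
    Spec.map (CommRingCat.ofHom (residueStructMap π v)) = X.fromSpecResidueField v ≫ π :=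
  Spec.map_preimage _

theorem pointOf_comp_eq_iff (π : X ⟶ Spec (.of F)) (v : X) (φ : X.residueField v →+* Ω) :
    pointOf v φ ≫ π = Spec.map (CommRingCat.ofHom (algebraMap F Ω)) ↔
      φ.comp (residueStructMap π v) = algebraMap F Ω := by
  rw [pointOf, Category.assoc, ← specMap_residueStructMap, ← Spec.map_comp,
    Spec.map_injective.eq_iff]
  constructor
  · exact fun h => congrArg CommRingCat.Hom.hom h
  · exact fun h => congrArg CommRingCat.ofHom h

/-- On a Jacobson scheme, closedness of `v` makes the inclusion of its residue field spectrum
locally of finite type. The residue field is then a finitely generated `F`-algebra, hence finite by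
the Nullstellensatz. -/
theorem finite_residueStructMap (π : X ⟶ Spec (.of F)) [LocallyOfFiniteType π] {v : X}
    (hv : IsClosed ({v} : Set X)) : (residueStructMap π v).Finite := by
  have : JacobsonSpace X := LocallyOfFiniteType.jacobsonSpace π
  have := isClosed_singleton_iff_locallyOfFiniteType.1 hv
  have h1 : LocallyOfFiniteType (Spec.map (CommRingCat.ofHom (residueStructMap π v))) := by
    rw [specMap_residueStructMap]; infer_instance
  have h2 : (residueStructMap π v).FiniteType :=
    (HasRingHomProperty.Spec_iff (P := @LocallyOfFiniteType)).1 h1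
  algebraize [residueStructMap π v]
  exact finite_of_finite_type_of_isJacobsonRing F (X.residueField v)

/-- A finite residue field is finite over `F`, so its spectrum is of finite type over `F` and
therefore locally of finite type over `X`. -/
theorem isClosed_of_finite_residueField (π : X ⟶ Spec (.of F)) [LocallyOfFiniteType π] {v : X}
    (hv : Finite (X.residueField v)) : IsClosed ({v} : Set X) := by
  have : JacobsonSpace X := LocallyOfFiniteType.jacobsonSpace π
  rw [isClosed_singleton_iff_locallyOfFiniteType]
  have h1 : LocallyOfFiniteType (X.fromSpecResidueField v ≫ π) := by
    rw [← specMap_residueStructMap]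
    refine (HasRingHomProperty.Spec_iff (P := @LocallyOfFiniteType)).2
      (RingHom.Finite.finiteType ?_)
    algebraize [residueStructMap π v]
    exact Module.Finite.of_finite
  exact locallyOfFiniteType_of_comp _ π

theorem residueDegree_pos (π : X ⟶ Spec (.of F)) [LocallyOfFiniteType π] {v : X}
    (hv : IsClosed ({v} : Set X)) : 0 < residueDegree π v := by
  have := finite_residueStructMap π hv
  algebraize [residueStructMap π v]
  exact Module.finrank_pos (R := F) (M := X.residueField v)

theorem finite_residueField [Finite F] (π : X ⟶ Spec (.of F)) [LocallyOfFiniteType π] {v : X}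
    (hv : IsClosed ({v} : Set X)) : Finite (X.residueField v) := by
  have := finite_residueStructMap π hv
  algebraize [residueStructMap π v]
  exact Module.finite_of_finite F

theorem residueCard_eq_pow (π : X ⟶ Spec (.of F)) [LocallyOfFiniteType π] {v : X}
    (hv : IsClosed ({v} : Set X)) : residueCard v = Nat.card F ^ residueDegree π v := by
  have := finite_residueStructMap π hv
  algebraize [residueStructMap π v]
  exact Module.natCard_eq_pow_finrank (K := F) (V := X.residueField v)

theorem exists_residueEmbedding [IsAlgClosed Ω] (π : X ⟶ Spec (.of F)) [LocallyOfFiniteType π]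
    {v : X} (hv : IsClosed ({v} : Set X)) :
    ∃ φ : X.residueField v →+* Ω, φ.comp (residueStructMap π v) = algebraMap F Ω := by
  have := finite_residueStructMap π hv
  algebraize [residueStructMap π v]
  let φ : X.residueField v →ₐ[F] Ω := IsAlgClosed.lift
  exact ⟨φ, φ.comp_algebraMap⟩

theorem exists_pointOf_comp_eq [IsAlgClosed Ω] (π : X ⟶ Spec (.of F)) [LocallyOfFiniteType π]
    (v : ClosedPoint X) : ∃ φ : X.residueField v.1 →+* Ω,
      pointOf v.1 φ ≫ π = Spec.map (CommRingCat.ofHom (algebraMap F Ω)) := by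
  obtain ⟨φ, hφ⟩ := exists_residueEmbedding (Ω := Ω) π v.2
  exact ⟨φ, (pointOf_comp_eq_iff π v.1 φ).2 hφ⟩

end GeomPoints

/-! ### Closed points as orbits of the Frobenius -/

section ClosedPoints

variable {F Ω : Type u} [Field F] [Field Ω] [Algebra F Ω] {X U : Scheme.{u}}

theorem IsRealization.conj_iterate {π : X ⟶ Spec (.of F)} {S : DefSet F Ω}
    {e : GeomPoint Ω π ≃ S.carrier} (he : IsRealization π S e) (σ : Ω ≃ₐ[F] Ω) (k : ℕ)
    (y : GeomPoint Ω π) : (S.perm σ)^[k] (e y) = e ((GeomPoint.conj π σ)^[k] y) :=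
  ((Function.Semiconj.iterate_right (he.conj σ) k) y).symm

theorem IsRealization.perm_iterate_eq_iff {π : X ⟶ Spec (.of F)} {S : DefSet F Ω}
    {e : GeomPoint Ω π ≃ S.carrier} (he : IsRealization π S e) (σ : Ω ≃ₐ[F] Ω) (k : ℕ)
    (y z : GeomPoint Ω π) : (S.perm σ)^[k] (e y) = e z ↔
      Spec.map (CommRingCat.ofHom ((σ ^ k : Ω ≃ₐ[F] Ω) : Ω →+* Ω)) ≫ y.1 = z.1 := by
  rw [he.conj_iterate, e.injective.eq_iff, ← GeomPoint.conj_iterate_coe]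
  exact Subtype.ext_iff

variable {σ : Ω ≃ₐ[F] Ω} (hσ : ∀ z, σ z = z ^ Nat.card F)

include hσ in
theorem frobenius_pow_comp_eq_iff {K : Type*} [Field K] (φ : K →+* Ω) (k : ℕ) :
    ((σ ^ k : Ω ≃ₐ[F] Ω) : Ω →+* Ω).comp φ = φ ↔ ∀ z : K, z ^ (Nat.card F ^ k) = z := by
  rw [RingHom.ext_iff]
  refine forall_congr' fun z => ?_
  rw [← φ.injective.eq_iff (a := z ^ (Nat.card F ^ k)), map_pow, ← iterate_pow_natCard hσ,
    ← AlgEquiv.coe_pow]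
  rfl

include hσ in
-- The periods of a geometric point depend only on the residue field, because embeddings of fields
-- are injective.
theorem frobenius_pow_pointOf_eq_iff (v : X) (φ : X.residueField v →+* Ω) (k : ℕ) :
    Spec.map (CommRingCat.ofHom ((σ ^ k : Ω ≃ₐ[F] Ω) : Ω →+* Ω)) ≫ pointOf v φ = pointOf v φ ↔
      ∀ z : X.residueField v, z ^ (Nat.card F ^ k) = z := by
  rw [specMap_comp_pointOf, (pointOf_injective v).eq_iff, frobenius_pow_comp_eq_iff hσ]

variable [Finite F] {π : X ⟶ Spec (.of F)} [LocallyOfFiniteType π]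

include hσ in
-- Period `k` means that `z ^ (q ^ k) = z` throughout the residue field. This holds for `k = deg v`,
-- and it forces `q ^ deg v ≤ q ^ k` by counting roots.
theorem minimalPeriod_pointOf {S : DefSet F Ω} {e : GeomPoint Ω π ≃ S.carrier}
    (he : IsRealization π S e) {v : X} (hv : IsClosed ({v} : Set X)) (φ : X.residueField v →+* Ω)
    (hφ : pointOf v φ ≫ π = Spec.map (CommRingCat.ofHom (algebraMap F Ω))) :
    Function.minimalPeriod (S.perm σ) (e ⟨pointOf v φ, hφ⟩) = residueDegree π v := by
  have hfin := finite_residueField π hv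
  have hcard : Nat.card (X.residueField v) = Nat.card F ^ residueDegree π v :=
    residueCard_eq_pow π hv
  have hF : 1 < Nat.card F := Finite.one_lt_card
  have key : ∀ k, Function.IsPeriodicPt (S.perm σ) k (e ⟨pointOf v φ, hφ⟩) ↔
      ∀ z : X.residueField v, z ^ (Nat.card F ^ k) = z := fun k => by
    rw [← frobenius_pow_pointOf_eq_iff hσ v φ k]
    exact he.perm_iterate_eq_iff σ k _ _
  have hper : Function.IsPeriodicPt (S.perm σ) (residueDegree π v) (e ⟨pointOf v φ, hφ⟩) := by
    refine (key _).2 fun z => ?_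
    rw [← hcard]
    exact (pow_natCard_eq_self_iff (RingHom.id (X.residueField v))).2 ⟨z, rfl⟩
  have hpos := residueDegree_pos π hv
  refine le_antisymm (hper.minimalPeriod_le hpos) ?_
  have h1 := (key _).1 (Function.isPeriodicPt_minimalPeriod (S.perm σ) (e ⟨pointOf v φ, hφ⟩))
  have hp := hper.minimalPeriod_pos hpos
  have h2 := (finite_and_card_le_of_pow_eq_self (Nat.one_lt_pow hp.ne' hF) h1).2
  rw [hcard] at h2
  exact (Nat.pow_le_pow_iff_right hF).1 h2

include hσ in
-- Periodicity bounds the size of the residue field, so the underlying point is closed. Any two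
-- embeddings of its residue field over `F` differ by a power of Frobenius, whence the freedom in
-- the choice of `φ`.
theorem exists_orbit_of_periodic {S : DefSet F Ω} {e : GeomPoint Ω π ≃ S.carrier}
    (he : IsRealization π S e) {z : S.carrier} (hz : z ∈ Function.periodicPts (S.perm σ)) :
    ∃ v : ClosedPoint X, ∀ (φ : X.residueField v.1 →+* Ω)
      (hφ : pointOf v.1 φ ≫ π = Spec.map (CommRingCat.ofHom (algebraMap F Ω))),
      ∃ k, (S.perm σ)^[k] (e ⟨pointOf v.1 φ, hφ⟩) = z := by
  obtain ⟨⟨y, hy⟩, rfl⟩ := e.surjective z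
  obtain ⟨v, ψ, rfl⟩ := exists_eq_pointOf y
  obtain ⟨k, hk, hper⟩ := hz
  have hF : 1 < Nat.card F := Finite.one_lt_card
  have h1 := (frobenius_pow_pointOf_eq_iff hσ v ψ k).1 ((he.perm_iterate_eq_iff σ k _ _).1 hper)
  have hfin := (finite_and_card_le_of_pow_eq_self (Nat.one_lt_pow hk.ne' hF) h1).1
  have hv := isClosed_of_finite_residueField π hfin
  refine ⟨⟨v, hv⟩, fun φ hφ => ?_⟩
  have hψ' := (pointOf_comp_eq_iff π v ψ).1 hy
  have hφ' := (pointOf_comp_eq_iff π v φ).1 hφ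
  let _ : Algebra F (X.residueField v) := (residueStructMap π v).toAlgebra
  let φ' : X.residueField v →ₐ[F] Ω := { φ with commutes' := fun a => DFunLike.congr_fun hφ' a }
  let ψ' : X.residueField v →ₐ[F] Ω := { ψ with commutes' := fun a => DFunLike.congr_fun hψ' a }
  obtain ⟨l, hl⟩ := exists_pow_eq_of_algHom φ' ψ'
  refine ⟨l, (he.perm_iterate_eq_iff σ l _ _).2 ?_⟩
  change Spec.map _ ≫ pointOf v φ = pointOf v ψ
  rw [specMap_comp_pointOf]
  congr 1
  ext z
  refine Eq.trans ?_ (hl z).symm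
  change (σ ^ l) (φ z) = φ z ^ _
  rw [← iterate_pow_natCard hσ, AlgEquiv.coe_pow]

/-- Field extensions are faithfully flat. Equalities of morphisms out of the spectrum of a residue
field can thus be tested over `Ω`. -/
theorem epi_specMap_of_field {K L : Type u} [Field K] [Field L] (φ : K →+* L) :
    Epi (Spec.map (CommRingCat.ofHom φ)) := by
  have h1 : Flat (Spec.map (CommRingCat.ofHom φ)) := by
    refine (HasRingHomProperty.Spec_iff (P := @Flat)).2 ?_
    algebraize [φ]
    change Module.Flat K L
    infer_instance
  have h2 : Surjective (Spec.map (CommRingCat.ofHom φ)) := by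
    refine ⟨fun a => ⟨IsLocalRing.closedPoint L, Subsingleton.elim (α := PrimeSpectrum K) _ _⟩⟩
  exact Flat.epi_of_flat_of_surjective _

/-- Points of the fibre over the residue field are lifts of the canonical point. -/
def fiberPointEquiv (g : U ⟶ X) (v : X) :
    {h : Spec (X.residueField v) ⟶ g.fiber v // h ≫ g.fiberToSpecResidueField v = 𝟙 _} ≃
      {h : Spec (X.residueField v) ⟶ U // h ≫ g = X.fromSpecResidueField v} where
  toFun h := ⟨h.1 ≫ g.fiberι v, by
    rw [Category.assoc, Scheme.Hom.fiber_fac, ← Category.assoc, h.2, Category.id_comp]⟩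
  invFun h := ⟨Limits.pullback.lift h.1 (𝟙 _) (by rw [h.2, Category.id_comp]),
    Limits.pullback.lift_snd _ _ _⟩
  left_inv h := Subtype.ext (Limits.pullback.hom_ext
    (Limits.pullback.lift_fst _ _ _) ((Limits.pullback.lift_snd _ _ _).trans h.2.symm))
  right_inv h := Subtype.ext (Limits.pullback.lift_fst _ _ _)

include hσ in
-- Composition with `Spec φ` sends `F_v`-points above `v` to `Ω`-points above the chosen geometric
-- point, and `σ ^ deg v` fixes them because it fixes the image of `φ`. The map is injective because
-- `Spec φ` is an epimorphism, and surjective by Galois descent for residue fields.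
theorem fiberCount_eq (g : U ⟶ X) {SX SU : DefSet F Ω} {eX : GeomPoint Ω π ≃ SX.carrier}
    {eU : GeomPoint Ω (g ≫ π) ≃ SU.carrier} (hU : IsRealization (g ≫ π) SU eU)
    {v : X} (hv : IsClosed ({v} : Set X)) (φ : X.residueField v →+* Ω)
    (hφ : pointOf v φ ≫ π = Spec.map (CommRingCat.ofHom (algebraMap F Ω))) :
    fiberCount g v = Nat.card {y : SU.carrier //
      eX (GeomPoint.map π g (eU.symm y)) = eX ⟨pointOf v φ, hφ⟩ ∧
        (SU.perm σ)^[residueDegree π v] y = y} := by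
  have hfin := finite_residueField π hv
  have hcard : Nat.card (X.residueField v) = Nat.card F ^ residueDegree π v :=
    residueCard_eq_pow π hv
  have hepi := epi_specMap_of_field φ
  have hfix : ((σ ^ residueDegree π v : Ω ≃ₐ[F] Ω) : Ω →+* Ω).comp φ = φ := by
    refine (frobenius_pow_comp_eq_iff hσ φ _).2 fun z => ?_
    rw [← hcard]
    exact (pow_natCard_eq_self_iff (RingHom.id (X.residueField v))).2 ⟨z, rfl⟩
  refine Nat.card_congr ((fiberPointEquiv g v).trans (Equiv.ofBijective
    (fun h => ⟨eU ⟨Spec.map (CommRingCat.ofHom φ) ≫ h.1, ?_⟩, ?_, ?_⟩) ⟨?_, ?_⟩))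
  · rw [Category.assoc, ← Category.assoc h.1, h.2, ← Category.assoc]
    exact hφ
  · refine congrArg eX ((congrArg (GeomPoint.map π g) (eU.symm_apply_apply _)).trans
      (Subtype.ext ?_))
    change (Spec.map (CommRingCat.ofHom φ) ≫ h.1) ≫ g = _
    rw [Category.assoc, h.2]
    rfl
  · refine (hU.perm_iterate_eq_iff σ _ _ _).2 ?_
    rw [← Category.assoc, ← Spec.map_comp, ← CommRingCat.ofHom_comp, hfix]
  · intro h h' hh
    have h1 := congrArg Subtype.val (eU.injective (congrArg Subtype.val hh))
    exact Subtype.ext ((cancel_epi _).1 h1)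
  · rintro ⟨y, hy1, hy2⟩
    obtain ⟨⟨y, hy⟩, rfl⟩ := eU.surjective y
    replace hy1 := congrArg Subtype.val ((congrArg (GeomPoint.map π g)
      (eU.symm_apply_apply _)).symm.trans (eX.injective hy1))
    replace hy2 := (hU.perm_iterate_eq_iff σ _ _ _).1 hy2
    change y ≫ g = pointOf v φ at hy1
    obtain ⟨w, ψ, rfl⟩ := exists_eq_pointOf y
    -- A fixed point has coordinates satisfying `z ^ q_v = z`, and the solutions of this equation in
    -- `Ω` form exactly the image of `F_v`. Hence `ψ` factors through `φ`.
    have hψ : ∀ z, ψ z ∈ φ.range := by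
      intro z
      refine (pow_natCard_eq_self_iff φ).1 ?_
      rw [← map_pow, hcard, (frobenius_pow_pointOf_eq_iff hσ w ψ _).1 hy2]
    obtain ⟨χ, hχ⟩ : ∃ χ : U.residueField w →+* X.residueField v, φ.comp χ = ψ := by
      let ε := RingEquiv.ofBijective φ.rangeRestrict ⟨fun a b h =>
        φ.injective (congrArg Subtype.val h), φ.rangeRestrict_surjective⟩
      refine ⟨(ε.symm : φ.range →+* X.residueField v).comp (ψ.codRestrict φ.range hψ), ?_⟩
      ext z
      exact congrArg Subtype.val (ε.apply_symm_apply (ψ.codRestrict φ.range hψ z))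
    have h1 : Spec.map (CommRingCat.ofHom φ) ≫
        (Spec.map (CommRingCat.ofHom χ) ≫ U.fromSpecResidueField w) = pointOf w ψ := by
      rw [← hχ, pointOf, CommRingCat.ofHom_comp, Spec.map_comp, Category.assoc]
    refine ⟨⟨Spec.map (CommRingCat.ofHom χ) ≫ U.fromSpecResidueField w, ?_⟩, ?_⟩
    · rw [← cancel_epi (Spec.map (CommRingCat.ofHom φ))]
      exact (Category.assoc _ _ _).symm.trans ((congrArg (· ≫ g) h1).trans hy1)
    · exact Subtype.ext (congrArg eU (Subtype.ext h1))

end ClosedPoints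

/-! ### Values of sections at geometric points -/

section SectionValues

variable {F Ω : Type u} [Field F] [Field Ω] [Algebra F Ω] {X U : Scheme.{u}}

/-- Evaluation at an `Ω`-point of an open subscheme. -/
def secEvalHom (x : Spec (.of Ω) ⟶ X) (V : X.Opens) (h : ⊤ ≤ x ⁻¹ᵁ V) : Γ(X, V) →+* Ω :=
  (x.appLE V ⊤ h ≫ (Scheme.ΓSpecIso (.of Ω)).hom).hom

open Classical in
/-- The value of a section at an `Ω`-point, extended by zero. -/
def secEval (x : Spec (.of Ω) ⟶ X) (V : X.Opens) (s : Γ(X, V)) : Ω :=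
  if h : ⊤ ≤ x ⁻¹ᵁ V then secEvalHom x V h s else 0

theorem secEval_of_le {x : Spec (.of Ω) ⟶ X} {V : X.Opens} (h : ⊤ ≤ x ⁻¹ᵁ V) (s : Γ(X, V)) :
    secEval x V s = secEvalHom x V h s := dif_pos h

theorem secEval_of_not_le {x : Spec (.of Ω) ⟶ X} {V : X.Opens} (h : ¬ ⊤ ≤ x ⁻¹ᵁ V) (s : Γ(X, V)) :
    secEval x V s = 0 := dif_neg h

theorem top_le_preimage_iff {x : Spec (.of Ω) ⟶ X} {V : X.Opens} :
    ⊤ ≤ x ⁻¹ᵁ V ↔ x (IsLocalRing.closedPoint Ω) ∈ V := by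
  constructor
  · exact fun h => h (x := IsLocalRing.closedPoint Ω) trivial
  · intro h a _
    have : a = IsLocalRing.closedPoint Ω := Subsingleton.elim (α := PrimeSpectrum Ω) _ _
    rwa [this]

theorem secEvalHom_map {x : Spec (.of Ω) ⟶ X} {V W : X.Opens} (h : ⊤ ≤ x ⁻¹ᵁ V) (hVW : V ≤ W)
    (s : Γ(X, W)) : secEvalHom x V h (X.presheaf.map (homOfLE hVW).op s) =
      secEvalHom x W (h.trans fun _ ha => hVW ha) s := by
  unfold secEvalHom
  rw [← Scheme.Hom.map_appLE x h (homOfLE hVW).op, Category.assoc]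
  rfl

theorem secEvalHom_comp (y : Spec (.of Ω) ⟶ U) (g : U ⟶ X) (V : X.Opens)
    (h : ⊤ ≤ (y ≫ g) ⁻¹ᵁ V) (s : Γ(X, V)) :
    secEvalHom (y ≫ g) V h s = secEvalHom y (g ⁻¹ᵁ V) h (g.app V s) := by
  unfold secEvalHom
  rw [Scheme.Hom.comp_appLE, Category.assoc]
  rfl

theorem secEvalHom_ne_zero_iff {x : Spec (.of Ω) ⟶ X} {V : X.Opens} (h : ⊤ ≤ x ⁻¹ᵁ V)
    (s : Γ(X, V)) : secEvalHom x V h s ≠ 0 ↔ ⊤ ≤ x ⁻¹ᵁ X.basicOpen s := by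
  have h1 : secEvalHom x V h s ≠ 0 ↔ IsUnit (x.appLE V ⊤ h s) := by
    rw [← isUnit_iff_ne_zero]
    exact isUnit_map_iff (Scheme.ΓSpecIso (.of Ω)).commRingCatIsoToRingEquiv (x.appLE V ⊤ h s)
  have h2 : (Spec (.of Ω)).basicOpen (x.appLE V ⊤ h s) = x ⁻¹ᵁ X.basicOpen s := by
    rw [Scheme.basicOpen_appLE, top_inf_eq]
  have h3 : IsUnit (x.appLE V ⊤ h s) ↔ (Spec (.of Ω)).basicOpen (x.appLE V ⊤ h s) = ⊤ := by
    constructor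
    · exact fun hu => Scheme.basicOpen_of_isUnit _ hu
    · intro htop
      rw [← h1]
      intro h0
      have h0' : x.appLE V ⊤ h s = 0 :=
        (ConcreteCategory.bijective_of_isIso (Scheme.ΓSpecIso (.of Ω)).hom).1
          (h0.trans (map_zero (Scheme.ΓSpecIso (.of Ω)).hom.hom).symm)
      rw [h0', Scheme.basicOpen_zero] at htop
      exact (top_ne_bot htop.symm).elim
  rw [h1, h3, ← h2, top_le_iff]

theorem evalAt_opens (V : X.Opens) (z : Spec (.of Ω) ⟶ V) (h : ⊤ ≤ (z ≫ V.ι) ⁻¹ᵁ V) (s : Γ(X, V)) :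
    secEvalHom (z ≫ V.ι) V h s = evalAt z (V.topIso.inv s) := by
  have h0 : ⊤ ≤ z ⁻¹ᵁ ⊤ := le_top
  have hι : V.ι.appLE V ⊤ (by simp) = V.topIso.inv := by
    rw [Scheme.Opens.ι_appLE]
    rfl
  have h1 : (z ≫ V.ι).appLE V ⊤ h = V.topIso.inv ≫ z.appTop := by
    rw [← hι, ← show z.appLE ⊤ ⊤ h0 = z.appTop from z.appLE_eq_app]
    exact (Scheme.Hom.appLE_comp_appLE _ _ _ _ _ _ _).symm
  unfold secEvalHom evalAt
  rw [h1]
  rfl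

/-- Makes it possible to construct an `Ω`-point with prescribed values of sections over an affine
open. -/
theorem secEvalHom_fromSpec {V : X.Opens} (hV : IsAffineOpen V) (ψ : Γ(X, V) →+* Ω)
    (h : ⊤ ≤ (Spec.map (CommRingCat.ofHom ψ) ≫ hV.fromSpec) ⁻¹ᵁ V) :
    secEvalHom (Spec.map (CommRingCat.ofHom ψ) ≫ hV.fromSpec) V h = ψ := by
  let f : Spec (.of Ω) ⟶ Spec Γ(X, V) := Spec.map (CommRingCat.ofHom ψ)
  have h' : ⊤ ≤ f ⁻¹ᵁ (hV.fromSpec ⁻¹ᵁ V) := h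
  have h1 : f.appLE ⊤ ⊤ le_top = f.appTop := f.appLE_eq_app
  have h2 : (f ≫ hV.fromSpec).appLE V ⊤ h = (Scheme.ΓSpecIso Γ(X, V)).inv ≫ f.appTop := by
    have h3 : (f ≫ hV.fromSpec).appLE V ⊤ h = hV.fromSpec.app V ≫ f.appLE _ ⊤ h' :=
      Scheme.Hom.comp_appLE _ _ _ _ _
    rw [h3, hV.fromSpec_app_self, Category.assoc, Scheme.Hom.map_appLE, h1]
  have h4 : (f ≫ hV.fromSpec).appLE V ⊤ h ≫ (Scheme.ΓSpecIso (.of Ω)).hom =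
      CommRingCat.ofHom ψ := by
    rw [h2, Category.assoc, Scheme.ΓSpecIso_naturality, Iso.inv_hom_id_assoc]
  exact congrArg CommRingCat.Hom.hom h4

theorem eq_of_secEvalHom_eq {x y : Spec (.of Ω) ⟶ X} {V : X.Opens} (hV : IsAffineOpen V)
    (hx : ⊤ ≤ x ⁻¹ᵁ V) (hy : ⊤ ≤ y ⁻¹ᵁ V) (h : secEvalHom x V hx = secEvalHom y V hy) : x = y := by
  obtain ⟨x', rfl⟩ := exists_lift_of_mem x (top_le_preimage_iff.1 hx)
  obtain ⟨y', rfl⟩ := exists_lift_of_mem y (top_le_preimage_iff.1 hy)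
  have : IsAffine V := hV
  congr 1
  refine eq_of_evalAt_eq fun f => ?_
  obtain ⟨s, rfl⟩ := (ConcreteCategory.bijective_of_isIso V.topIso.inv).2 f
  rw [← evalAt_opens V x' hx, ← evalAt_opens V y' hy, h]

/-- The structure map of the sections of an `F`-scheme. -/
def sectionStructMap (π : X ⟶ Spec (.of F)) (V : X.Opens) : F →+* Γ(X, V) :=
  ((Scheme.ΓSpecIso (.of F)).inv ≫ π.appLE ⊤ V le_top).hom

omit [Algebra F Ω] in
theorem secEvalHom_comp_sectionStructMap (π : X ⟶ Spec (.of F)) {V : X.Opens}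
    {x : Spec (.of Ω) ⟶ X} (h : ⊤ ≤ x ⁻¹ᵁ V) (a : F) :
    secEvalHom x V h (sectionStructMap π V a) =
      evalAt (x ≫ π) ((Scheme.ΓSpecIso (.of F)).inv a) := by
  have h1 : π.appLE ⊤ V le_top ≫ x.appLE V ⊤ h = (x ≫ π).appTop :=
    (Scheme.Hom.appLE_comp_appLE _ _ _ _ _ _ _).trans (x ≫ π).appLE_eq_app
  exact congrArg (fun φ => (Scheme.ΓSpecIso (.of Ω)).hom.hom
    (φ.hom ((Scheme.ΓSpecIso (.of F)).inv a))) h1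

theorem comp_eq_iff_secEvalHom (π : X ⟶ Spec (.of F)) {V : X.Opens} {x : Spec (.of Ω) ⟶ X}
    (h : ⊤ ≤ x ⁻¹ᵁ V) : x ≫ π = Spec.map (CommRingCat.ofHom (algebraMap F Ω)) ↔
      ∀ a, secEvalHom x V h (sectionStructMap π V a) = algebraMap F Ω a := by
  have key : ∀ a, evalAt (Spec.map (CommRingCat.ofHom (algebraMap F Ω)))
      ((Scheme.ΓSpecIso (.of F)).inv a) = algebraMap F Ω a := by
    intro a
    have := congrArg (fun φ => φ.hom ((Scheme.ΓSpecIso (.of F)).inv a))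
      (Scheme.ΓSpecIso_naturality (CommRingCat.ofHom (algebraMap F Ω)))
    refine this.trans ?_
    change algebraMap F Ω (((Scheme.ΓSpecIso (.of F)).inv ≫ (Scheme.ΓSpecIso (.of F)).hom) a) = _
    rw [Iso.inv_hom_id]
    rfl
  constructor
  · intro hx a
    rw [secEvalHom_comp_sectionStructMap, hx, key]
  · intro hx
    refine eq_of_evalAt_eq fun f => ?_
    obtain ⟨a, rfl⟩ := (ConcreteCategory.bijective_of_isIso (Scheme.ΓSpecIso (.of F)).inv).2 f
    exact (secEvalHom_comp_sectionStructMap π h a).symm.trans ((hx a).trans (key a).symm)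

theorem exists_coordinates (π : X ⟶ Spec (.of F)) [LocallyOfFiniteType π] {V : X.Opens}
    (hV : IsAffineOpen V) : ∃ (m : ℕ) (p : MvPolynomial (Fin m) F →+* Γ(X, V)),
      Function.Surjective p ∧ ∀ a, p (.C a) = sectionStructMap π V a := by
  have h1 : (π.appLE ⊤ V le_top).hom.FiniteType := π.finiteType_appLE (isAffineOpen_top _) hV _
  have h2 : (sectionStructMap π V).FiniteType := by
    refine RingHom.FiniteType.comp h1 (RingHom.FiniteType.of_surjective _ ?_)
    exact (ConcreteCategory.bijective_of_isIso (Scheme.ΓSpecIso (.of F)).inv).2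
  algebraize [sectionStructMap π V]
  obtain ⟨m, p, hp⟩ := Algebra.FiniteType.iff_quotient_mvPolynomial''.1 h2
  exact ⟨m, p, hp, fun a => p.commutes a⟩

/-- Points of open subschemes are traded for points of `X` that land in `V`, with values extended by
zero. Different opens can then be compared at the same point. -/
theorem isRealization_iff {π : X ⟶ Spec (.of F)} {S : DefSet F Ω} {e : GeomPoint Ω π ≃ S.carrier} :
    IsRealization π S e ↔ ∀ (V : X.Opens) (s : Γ(X, V)), IsDefinable F
      {w : Unit ⊕ Fin S.dim → Ω | ∃ x : GeomPoint Ω π, ⊤ ≤ x.1 ⁻¹ᵁ V ∧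
        w = Sum.elim (fun _ => secEval x.1 V s) (e x).1} := by
  have key : ∀ (V : X.Opens) (s : Γ(X, V)),
      {w : Unit ⊕ Fin S.dim → Ω |
        ∃ (y : Spec (.of Ω) ⟶ V)
          (hy : (y ≫ V.ι) ≫ π = Spec.map (CommRingCat.ofHom (algebraMap F Ω))),
          w = Sum.elim (fun _ => evalAt y (V.topIso.inv s)) (e ⟨y ≫ V.ι, hy⟩).1} =
      {w : Unit ⊕ Fin S.dim → Ω | ∃ x : GeomPoint Ω π, ⊤ ≤ x.1 ⁻¹ᵁ V ∧
        w = Sum.elim (fun _ => secEval x.1 V s) (e x).1} := by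
    intro V s
    ext w
    constructor
    · rintro ⟨y, hy, rfl⟩
      have h : ⊤ ≤ (y ≫ V.ι) ⁻¹ᵁ V := top_le_preimage_iff.2 (y (IsLocalRing.closedPoint Ω)).2
      refine ⟨⟨y ≫ V.ι, hy⟩, h, ?_⟩
      rw [← evalAt_opens V y h, ← secEval_of_le h]
    · rintro ⟨⟨x, hx⟩, h, rfl⟩
      obtain ⟨y, rfl⟩ := exists_lift_of_mem x (top_le_preimage_iff.1 h)
      refine ⟨y, hx, ?_⟩
      rw [← evalAt_opens V y h, ← secEval_of_le h]
  constructor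
  · intro h V s
    rw [← key]
    exact h V _
  · intro h V f
    obtain ⟨s, rfl⟩ := (ConcreteCategory.bijective_of_isIso V.topIso.inv).2 f
    rw [key]
    exact h V s

end SectionValues

theorem IsDefinable.exists_elim {F Ω α β : Type*} [Field F] [Field Ω] [Algebra F Ω] [Finite α]
    [Finite β] {s : Set (α ⊕ β → Ω)} (hs : IsDefinable F s) :
    IsDefinable F {c : β → Ω | ∃ t : α → Ω, Sum.elim t c ∈ s} := by
  refine .exists_vector ?_
  convert hs.preimage_comp (Sum.swap : α ⊕ β → β ⊕ α) using 1
  ext w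
  have : Sum.elim (w ∘ Sum.inr) (w ∘ Sum.inl) = w ∘ Sum.swap := by
    funext i
    rcases i with i | i <;> rfl
  simp only [Set.mem_ofPred_eq, Set.mem_preimage, this]

/-! ### Affine charts -/

section Charts

variable {F Ω : Type u} [Field F] [Field Ω] [Algebra F Ω] {X U : Scheme.{u}}

/-- On an affine open subscheme `V` every section is locally a fraction of sections over `V`. -/
theorem exists_local_fractions (Ω : Type u) [Field Ω] [TopologicalSpace.NoetherianSpace X]
    {V : X.Opens} (hV : IsAffineOpen V) (W : X.Opens) (f : Γ(X, W)) :
    ∃ T : Finset (Γ(X, V) × Γ(X, V)), ∀ x : Spec (.of Ω) ⟶ X, ⊤ ≤ x ⁻¹ᵁ V →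
      (∀ t ∈ T, secEval x V t.1 ≠ 0 →
        ⊤ ≤ x ⁻¹ᵁ W ∧ secEval x W f * secEval x V t.1 = secEval x V t.2) ∧
      (⊤ ≤ x ⁻¹ᵁ W → ∃ t ∈ T, secEval x V t.1 ≠ 0) := by
  classical
  have key : ∀ y : X, ∃ t : Γ(X, V) × Γ(X, V), (y ∈ V ⊓ W → y ∈ X.basicOpen t.1) ∧
      ∀ x : Spec (.of Ω) ⟶ X, ⊤ ≤ x ⁻¹ᵁ V → secEval x V t.1 ≠ 0 →
        ⊤ ≤ x ⁻¹ᵁ W ∧ secEval x W f * secEval x V t.1 = secEval x V t.2 := by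
    intro y
    by_cases hy : y ∈ V ⊓ W
    swap
    · refine ⟨0, fun h => (hy h).elim, fun x hx h => (h ?_).elim⟩
      rw [secEval_of_le hx]
      exact map_zero _
    obtain ⟨h, hW, hyh⟩ := hV.exists_basicOpen_le ⟨y, hy.2⟩ hy.1
    have := hV.isLocalization_basicOpen h
    obtain ⟨k, a, ha⟩ := IsLocalization.Away.surj h (X.presheaf.map (homOfLE hW).op f)
    -- The exponent is `k + 1` rather than `k` so that, even for `k = 0`, a nonzero denominator puts
    -- the point in the basic open set of `h`, where the fraction represents `f`.
    refine ⟨(h ^ (k + 1), a * h), fun _ => ?_, fun x hx hne => ?_⟩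
    · rw [X.basicOpen_pow h k.succ_pos]
      exact hyh
    · have hh : secEvalHom x V hx h ≠ 0 := by
        intro h0
        apply hne
        rw [secEval_of_le hx, map_pow, h0, zero_pow k.succ_ne_zero]
      have hD : ⊤ ≤ x ⁻¹ᵁ X.basicOpen h := (secEvalHom_ne_zero_iff hx h).1 hh
      have hxW : ⊤ ≤ x ⁻¹ᵁ W := hD.trans fun _ hz => hW hz
      refine ⟨hxW, ?_⟩
      have e : secEvalHom x W hxW f * secEvalHom x V hx h ^ k = secEvalHom x V hx a := by
        rw [← secEvalHom_map hD hW, ← secEvalHom_map hD (X.basicOpen_le h),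
          ← secEvalHom_map hD (X.basicOpen_le h), ← map_pow, ← map_mul]
        exact congrArg _ ha
      rw [secEval_of_le hx, secEval_of_le hx, secEval_of_le hxW, map_pow, map_mul, pow_succ,
        ← mul_assoc, e]
  choose t ht1 ht2 using key
  have hc : IsCompact ((V ⊓ W : X.Opens) : Set X) := TopologicalSpace.NoetherianSpace.isCompact _
  obtain ⟨s, hs⟩ := hc.elim_finite_subcover_image (b := ((V ⊓ W : X.Opens) : Set X))
    (c := fun y => (X.basicOpen (t y).1 : Set X))
    (fun y _ => (X.basicOpen (t y).1).2) (fun y hy => Set.mem_biUnion hy (ht1 y hy))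
  refine ⟨hs.2.1.toFinset.image t, fun x hx => ⟨?_, fun hxW => ?_⟩⟩
  · intro u hu
    obtain ⟨y, -, rfl⟩ := Finset.mem_image.1 hu
    exact ht2 y x hx
  · obtain ⟨y, hy, hxy⟩ := Set.mem_iUnion₂.1
      (hs.2.2 ⟨top_le_preimage_iff.1 hx, top_le_preimage_iff.1 hxW⟩)
    refine ⟨t y, Finset.mem_image_of_mem _ (hs.2.1.mem_toFinset.2 hy), ?_⟩
    rw [secEval_of_le hx]
    exact (secEvalHom_ne_zero_iff hx _).2 (top_le_preimage_iff.2 hxy)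

/-- An affine open subscheme with a closed embedding into an affine space. -/
structure AffineChart (π : X ⟶ Spec (.of F)) where
  opens : X.Opens
  isAffineOpen : IsAffineOpen opens
  dim : ℕ
  toSections : MvPolynomial (Fin dim) F →+* Γ(X, opens)
  surjective : Function.Surjective toSections
  toSections_C : ∀ a, toSections (.C a) = sectionStructMap π opens a

namespace AffineChart

variable {π : X ⟶ Spec (.of F)} (A : AffineChart π)

/-- The coordinates of an `Ω`-point in a chart. -/
def coord (x : GeomPoint Ω π) (j : Fin A.dim) : Ω := secEval x.1 A.opens (A.toSections (.X j))

variable {A}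

theorem secEvalHom_toSections {x : GeomPoint Ω π} (h : ⊤ ≤ x.1 ⁻¹ᵁ A.opens)
    (P : MvPolynomial (Fin A.dim) F) :
    secEvalHom x.1 A.opens h (A.toSections P) = MvPolynomial.aeval (A.coord x) P := by
  have h1 : (secEvalHom x.1 A.opens h).comp A.toSections =
      (MvPolynomial.aeval (A.coord x)).toRingHom := by
    refine MvPolynomial.ringHom_ext (fun a => ?_) fun j => ?_
    · refine (congrArg (secEvalHom x.1 A.opens h) (A.toSections_C a)).trans ?_
      refine ((comp_eq_iff_secEvalHom π h).1 x.2 a).trans ?_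
      exact (MvPolynomial.aeval_C _ a).symm
    · exact (secEval_of_le h _).symm.trans (MvPolynomial.aeval_X (A.coord x) j).symm
  exact congrArg (fun φ : _ →+* Ω => φ P) h1

theorem secEval_toSections {x : GeomPoint Ω π} (h : ⊤ ≤ x.1 ⁻¹ᵁ A.opens)
    (P : MvPolynomial (Fin A.dim) F) :
    secEval x.1 A.opens (A.toSections P) = MvPolynomial.aeval (A.coord x) P := by
  rw [secEval_of_le h, secEvalHom_toSections h]

theorem eq_of_coord_eq {x y : GeomPoint Ω π} (hx : ⊤ ≤ x.1 ⁻¹ᵁ A.opens)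
    (hy : ⊤ ≤ y.1 ⁻¹ᵁ A.opens) (h : A.coord x = A.coord y) : x = y := by
  refine Subtype.ext (eq_of_secEvalHom_eq A.isAffineOpen hx hy (RingHom.ext fun s => ?_))
  obtain ⟨P, rfl⟩ := A.surjective s
  rw [secEvalHom_toSections hx, secEvalHom_toSections hy, h]

/-- A tuple satisfying the relations among the generators defines a homomorphism from the sections
of the chart to `Ω`, hence a point. -/
theorem exists_coord_eq {c : Fin A.dim → Ω}
    (hc : ∀ P, A.toSections P = 0 → MvPolynomial.aeval c P = 0) :
    ∃ x : GeomPoint Ω π, ⊤ ≤ x.1 ⁻¹ᵁ A.opens ∧ A.coord x = c := by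
  let ψ : Γ(X, A.opens) →+* Ω := RingHom.liftOfSurjective A.toSections A.surjective
    ⟨(MvPolynomial.aeval c).toRingHom, fun P hP => hc P hP⟩
  have hψ : ∀ P, ψ (A.toSections P) = MvPolynomial.aeval c P := fun P =>
    RingHom.liftOfRightInverse_comp_apply _ _ _ _ P
  let x : Spec (.of Ω) ⟶ X := Spec.map (CommRingCat.ofHom ψ) ≫ A.isAffineOpen.fromSpec
  have h : ⊤ ≤ x ⁻¹ᵁ A.opens := by
    rw [top_le_preimage_iff]
    have := A.isAffineOpen.range_fromSpec
    rw [← SetLike.mem_coe, ← this]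
    exact ⟨_, rfl⟩
  have hx : secEvalHom x A.opens h = ψ := secEvalHom_fromSpec A.isAffineOpen ψ h
  refine ⟨⟨x, (comp_eq_iff_secEvalHom π h).2 fun a => ?_⟩, h, funext fun j => ?_⟩
  · rw [hx, ← A.toSections_C, hψ, MvPolynomial.aeval_C]
  · exact (secEval_of_le h _).trans (((congrArg (fun φ : _ →+* Ω => φ _) hx).trans (hψ _)).trans
      (MvPolynomial.aeval_X c j))

theorem exists_coord_eq_iff {c : Fin A.dim → Ω} :
    (∃ x : GeomPoint Ω π, ⊤ ≤ x.1 ⁻¹ᵁ A.opens ∧ A.coord x = c) ↔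
      ∀ P, A.toSections P = 0 → MvPolynomial.aeval c P = 0 := by
  refine ⟨?_, exists_coord_eq⟩
  rintro ⟨x, h, rfl⟩ P hP
  rw [← secEvalHom_toSections h, hP, map_zero]

variable (A) in
-- By the Hilbert basis theorem, finitely many relations cut out the image of a chart.
theorem isDefinable_range_coord : IsDefinable F {c : Fin A.dim → Ω |
    ∃ x : GeomPoint Ω π, ⊤ ≤ x.1 ⁻¹ᵁ A.opens ∧ A.coord x = c} := by
  obtain ⟨s, hs⟩ := (inferInstance : IsNoetherianRing (MvPolynomial (Fin A.dim) F)).noetherian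
    (RingHom.ker A.toSections)
  have h : ∀ c : Fin A.dim → Ω, (∃ x : GeomPoint Ω π, ⊤ ≤ x.1 ⁻¹ᵁ A.opens ∧ A.coord x = c) ↔
      ∀ P : s, MvPolynomial.aeval c P.1 = 0 := by
    intro c
    rw [exists_coord_eq_iff]
    have : (∀ P, A.toSections P = 0 → MvPolynomial.aeval c P = 0) ↔
        RingHom.ker A.toSections ≤ RingHom.ker (MvPolynomial.aeval (R := F) c) := Iff.rfl
    rw [this, ← hs, Submodule.span_le]
    exact ⟨fun h P => h P.2, fun h P hP => h ⟨P, hP⟩⟩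
  simp only [h]
  exact .forall_finite fun P => isDefinable_aeval_eq_zero P.1

variable (A) in
/-- A section over an open set is a definable partial function of the coordinates. -/
theorem isDefinable_secEval [TopologicalSpace.NoetherianSpace X] (W : X.Opens) (f : Γ(X, W)) :
    IsDefinable F {w : Unit ⊕ Fin A.dim → Ω | ∃ x : GeomPoint Ω π, ⊤ ≤ x.1 ⁻¹ᵁ A.opens ∧
      ⊤ ≤ x.1 ⁻¹ᵁ W ∧ w = Sum.elim (fun _ => secEval x.1 W f) (A.coord x)} := by
  obtain ⟨T, hT⟩ := exists_local_fractions Ω A.isAffineOpen W f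
  choose P hP using A.surjective
  -- The graph is described without division: some denominator from the finite list is nonzero, and
  -- its product with the value is the corresponding numerator.
  have h : ∀ w : Unit ⊕ Fin A.dim → Ω, (∃ x : GeomPoint Ω π, ⊤ ≤ x.1 ⁻¹ᵁ A.opens ∧
      ⊤ ≤ x.1 ⁻¹ᵁ W ∧ w = Sum.elim (fun _ => secEval x.1 W f) (A.coord x)) ↔
      (∃ x : GeomPoint Ω π, ⊤ ≤ x.1 ⁻¹ᵁ A.opens ∧ A.coord x = fun j => w (.inr j)) ∧
      ∃ t : T, ¬ MvPolynomial.aeval w (MvPolynomial.rename Sum.inr (P t.1.1)) = 0 ∧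
        MvPolynomial.aeval w (.X (.inl ()) * MvPolynomial.rename Sum.inr (P t.1.1)) =
          MvPolynomial.aeval w (MvPolynomial.rename Sum.inr (P t.1.2)) := by
    intro w
    have hw : ∀ x : GeomPoint Ω π, ⊤ ≤ x.1 ⁻¹ᵁ A.opens → (A.coord x = fun j => w (.inr j)) →
        ∀ s, MvPolynomial.aeval w (MvPolynomial.rename Sum.inr (P s)) =
          secEval x.1 A.opens s := by
      intro x hx hc s
      rw [MvPolynomial.aeval_rename, show w ∘ Sum.inr = A.coord x from hc.symm,
        ← secEval_toSections hx, hP]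
    constructor
    · rintro ⟨x, hx, hxW, rfl⟩
      refine ⟨⟨x, hx, rfl⟩, ?_⟩
      obtain ⟨t, ht, hne⟩ := (hT x.1 hx).2 hxW
      refine ⟨⟨t, ht⟩, ?_⟩
      rw [map_mul, MvPolynomial.aeval_X, hw x hx rfl, hw x hx rfl]
      exact ⟨hne, ((hT x.1 hx).1 t ht hne).2⟩
    · rintro ⟨⟨x, hx, hc⟩, t, ht⟩
      rw [map_mul, MvPolynomial.aeval_X, hw x hx hc, hw x hx hc] at ht
      obtain ⟨hxW, e⟩ := (hT x.1 hx).1 t.1 t.2 ht.1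
      refine ⟨x, hx, hxW, funext fun i => ?_⟩
      rcases i with ⟨⟩ | j
      · exact mul_right_cancel₀ ht.1 (ht.2.trans e.symm)
      · exact (congrFun hc j).symm
  simp only [h]
  exact .and (A.isDefinable_range_coord.mem_comp Sum.inr) (.exists_finite fun t =>
    .and (.not (isDefinable_aeval_eq_zero _)) (isDefinable_aeval_eq _ _))

variable (A) in
/-- The extension by zero of a section is a definable function of the coordinates. -/
theorem isDefinable_secEval_extend [TopologicalSpace.NoetherianSpace X] (W : X.Opens)
    (f : Γ(X, W)) : IsDefinable F {w : Unit ⊕ Fin A.dim → Ω |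
      ∃ x : GeomPoint Ω π, ⊤ ≤ x.1 ⁻¹ᵁ A.opens ∧
        w = Sum.elim (fun _ => secEval x.1 W f) (A.coord x)} := by
  have h1 := A.isDefinable_secEval (Ω := Ω) W f
  -- The graph of the section is completed by the value `0` at those coordinates of the chart that
  -- do not lie in the projection of this graph.
  refine Eq.mp (congrArg (IsDefinable F) ?_) (h1.union ((h1.exists_elim.compl.mem_comp
    Sum.inr).inter ((A.isDefinable_range_coord.mem_comp Sum.inr).inter
      (isDefinable_coord_eq_algebraMap (.inl ()) 0))))
  ext w
  constructor
  · rintro (⟨x, hx, -, h⟩ | ⟨hn, ⟨x, hx, hc⟩, h0⟩)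
    · exact ⟨x, hx, h⟩
    · refine ⟨x, hx, funext fun i => ?_⟩
      rcases i with ⟨⟩ | j
      · refine h0.trans ((map_zero _).trans (secEval_of_not_le (fun hW => hn ?_) f).symm)
        refine ⟨fun _ => secEval x.1 W f, x, hx, hW, ?_⟩
        rw [hc]
      · exact (congrFun hc j).symm
  · rintro ⟨x, hx, rfl⟩
    by_cases hW : ⊤ ≤ x.1 ⁻¹ᵁ W
    · exact .inl ⟨x, hx, hW, rfl⟩
    · refine .inr ⟨?_, ⟨x, hx, rfl⟩, (secEval_of_not_le hW f).trans (map_zero _).symm⟩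
      rintro ⟨t, y, hy, hyW, h⟩
      have : A.coord x = A.coord y := funext fun j => congrFun h (Sum.inr j)
      rw [eq_of_coord_eq hx hy this] at hW
      exact hW hyW

end AffineChart

theorem exists_finite_charts (π : X ⟶ Spec (.of F)) [LocallyOfFiniteType π] [QuasiCompact π] :
    ∃ (ι : Type u) (_ : Finite ι) (A : ι → AffineChart π), ∀ x : X, ∃ i, x ∈ (A i).opens := by
  have hX : CompactSpace X := (quasiCompact_iff_compactSpace π).1 inferInstance
  have hc : IsCompact ((⊤ : X.Opens) : Set X) := isCompact_univ
  obtain ⟨s, hs, h⟩ := isCompact_iff_finite_and_eq_biUnion_affineOpens.1 hc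
  have hA : ∀ V : s, ∃ A : AffineChart π, A.opens = V.1.1 := by
    intro V
    obtain ⟨m, p, hp, hpC⟩ := exists_coordinates π V.1.2
    exact ⟨⟨V.1.1, V.1.2, m, p, hp, hpC⟩, rfl⟩
  choose A hA using hA
  refine ⟨s, hs, A, fun x => ?_⟩
  have hx : x ∈ (⊤ : X.Opens) := trivial
  rw [h] at hx
  obtain ⟨V, hV, hxV⟩ := by simpa only [TopologicalSpace.Opens.mem_iSup] using hx
  exact ⟨⟨V, hV⟩, by rwa [hA]⟩

theorem noetherianSpace_of_finiteType (π : X ⟶ Spec (.of F)) [LocallyOfFiniteType π]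
    [QuasiCompact π] : TopologicalSpace.NoetherianSpace X := by
  have hX : CompactSpace X := (quasiCompact_iff_compactSpace π).1 inferInstance
  have : IsNoetherian X := { LocallyOfFiniteType.isLocallyNoetherian π with }
  infer_instance

/-- Sections are definable functions of the values of finitely many sections, provided the latter
separate points. -/
theorem isDefinable_secEval_family (π : X ⟶ Spec (.of F)) [LocallyOfFiniteType π] [QuasiCompact π]
    {L : Type*} [Finite L] (W : L → X.Opens) (f : ∀ l, Γ(X, W l)) (V : X.Opens) (s : Γ(X, V)) :
    IsDefinable F {w : Unit ⊕ L → Ω | ∃ x : GeomPoint Ω π, ⊤ ≤ x.1 ⁻¹ᵁ V ∧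
      w = Sum.elim (fun _ => secEval x.1 V s) (fun l => secEval x.1 (W l) (f l))} := by
  have := noetherianSpace_of_finiteType π
  obtain ⟨ι, _, A, hA⟩ := exists_finite_charts π
  have h : ∀ w : Unit ⊕ L → Ω, (∃ x : GeomPoint Ω π, ⊤ ≤ x.1 ⁻¹ᵁ V ∧
      w = Sum.elim (fun _ => secEval x.1 V s) (fun l => secEval x.1 (W l) (f l))) ↔
      -- All values are expressed through the coordinates `c` of one point in one chart. The
      -- witnesses for the various `l` agree since they share `c`; the extension by zero is needed
      -- as the point may lie outside `W l`.
      ∃ i, ∃ c : Fin (A i).dim → Ω,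
        (∃ x : GeomPoint Ω π, ⊤ ≤ x.1 ⁻¹ᵁ (A i).opens ∧ ⊤ ≤ x.1 ⁻¹ᵁ V ∧
          Sum.elim (fun _ => w (.inl ())) c =
            Sum.elim (fun _ : Unit => secEval x.1 V s) ((A i).coord x)) ∧
        ∀ l, ∃ x : GeomPoint Ω π, ⊤ ≤ x.1 ⁻¹ᵁ (A i).opens ∧
          Sum.elim (fun _ => w (.inr l)) c =
            Sum.elim (fun _ : Unit => secEval x.1 (W l) (f l)) ((A i).coord x) := by
    intro w
    constructor
    · rintro ⟨x, hxV, rfl⟩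
      obtain ⟨i, hi⟩ := hA (x.1 (IsLocalRing.closedPoint Ω))
      have hi' := top_le_preimage_iff.2 hi
      exact ⟨i, (A i).coord x, ⟨x, hi', hxV, rfl⟩, fun l => ⟨x, hi', rfl⟩⟩
    · rintro ⟨i, c, ⟨x, hx, hxV, hc⟩, h⟩
      refine ⟨x, hxV, funext fun j => ?_⟩
      rcases j with ⟨⟩ | l
      · exact congrFun hc (.inl ())
      · obtain ⟨y, hy, hl⟩ := h l
        have : x = y := AffineChart.eq_of_coord_eq hx hy (funext fun j =>
          (congrFun hc (.inr j)).symm.trans (congrFun hl (.inr j)))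
        rw [this]
        exact congrFun hl (.inl ())
  simp only [h]
  refine .exists_finite fun i => .exists_vector (.and ?_ (.forall_finite fun l => ?_))
  · convert ((A i).isDefinable_secEval (Ω := Ω) V s).preimage_comp
      (Sum.elim (fun _ => .inl (.inl ())) Sum.inr : Unit ⊕ Fin (A i).dim →
        (Unit ⊕ L) ⊕ Fin (A i).dim) using 1
    ext w
    have : Sum.elim (fun _ => (w ∘ Sum.inl) (.inl ())) (w ∘ Sum.inr) =
      w ∘ Sum.elim (fun _ : Unit => .inl (.inl ())) Sum.inr := by
      funext i
      rcases i with i | i <;> rfl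
    simp only [Set.mem_ofPred_eq, Set.mem_preimage, this]
  · convert ((A i).isDefinable_secEval_extend (Ω := Ω) (W l) (f l)).preimage_comp
      (Sum.elim (fun _ => .inl (.inr l)) Sum.inr : Unit ⊕ Fin (A i).dim →
        (Unit ⊕ L) ⊕ Fin (A i).dim) using 1
    ext w
    have : Sum.elim (fun _ => (w ∘ Sum.inl) (.inr l)) (w ∘ Sum.inr) =
      w ∘ Sum.elim (fun _ : Unit => .inl (.inr l)) Sum.inr := by
      funext i
      rcases i with i | i <;> rfl
    simp only [Set.mem_ofPred_eq, Set.mem_preimage, this]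

/-- The `Ω`-points of a scheme of finite type form a definable set. -/
theorem exists_isRealization (π : X ⟶ Spec (.of F)) [LocallyOfFiniteType π] [QuasiCompact π] :
    ∃ (S : DefSet F Ω) (e : GeomPoint Ω π ≃ S.carrier), IsRealization π S e := by
  obtain ⟨ι, _, A, hA⟩ := exists_finite_charts π
  let J := Σ i, Option (Fin (A i).dim)
  -- Besides the coordinates, each chart contributes the constant `1` at `none`: extended by zero,
  -- it records whether a point lies in the chart.
  let f (l : J) : Γ(X, (A l.1).opens) := l.2.elim 1 fun j => (A l.1).toSections (.X j)
  obtain ⟨N, ⟨r⟩⟩ := Finite.exists_equiv_fin J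
  let E (x : GeomPoint Ω π) (k : Fin N) : Ω := secEval x.1 (A (r.symm k).1).opens (f (r.symm k))
  have hE : ∀ x l, E x (r l) = secEval x.1 (A l.1).opens (f l) := by
    intro x l
    exact congrArg (fun l => secEval x.1 (A l.1).opens (f l)) (r.symm_apply_apply l)
  have hdef := isDefinable_secEval_family (Ω := Ω) π (fun k => (A (r.symm k).1).opens)
    fun k => f (r.symm k)
  have hinj : Function.Injective E := by
    intro x y hxy
    have hl : ∀ l : J, secEval x.1 (A l.1).opens (f l) = secEval y.1 (A l.1).opens (f l) :=
      fun l => (hE x l).symm.trans ((congrFun hxy _).trans (hE y l))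
    obtain ⟨i, hi⟩ := hA (x.1 (IsLocalRing.closedPoint Ω))
    have hx := top_le_preimage_iff.2 hi
    have hy : ⊤ ≤ y.1 ⁻¹ᵁ (A i).opens := by
      by_contra hy
      have := hl ⟨i, none⟩
      rw [secEval_of_le hx, secEval_of_not_le hy] at this
      exact one_ne_zero ((map_one _).symm.trans this)
    exact AffineChart.eq_of_coord_eq hx hy (funext fun j => hl ⟨i, some j⟩)
  have hS : IsDefinable F (Set.range E) := by
    -- The zero section over all of `X` imposes no condition, so projecting away its value leaves
    -- the image of `E`.
    refine Eq.mp (congrArg (IsDefinable F) ?_) (hdef ⊤ 0).exists_elim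
    ext u
    constructor
    · rintro ⟨t, x, -, h⟩
      exact ⟨x, funext fun k => (congrFun h (.inr k)).symm⟩
    · rintro ⟨x, rfl⟩
      exact ⟨_, x, le_top, rfl⟩
  exact ⟨⟨N, Set.range E, hS⟩, Equiv.ofInjective E hinj, isRealization_iff.2 hdef⟩

/-- Morphisms of schemes of finite type are definable. -/
theorem isDefinableMap_geomPointMap (π : X ⟶ Spec (.of F)) [LocallyOfFiniteType π] [QuasiCompact π]
    (g : U ⟶ X) {SX SU : DefSet F Ω} {eX : GeomPoint Ω π ≃ SX.carrier}
    {eU : GeomPoint Ω (g ≫ π) ≃ SU.carrier} (hX : IsRealization π SX eX)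
    (hU : IsRealization (g ≫ π) SU eU) :
    DefSet.IsDefinableMap (fun y : SU.carrier => eX (GeomPoint.map π g (eU.symm y))) := by
  obtain ⟨ι, _, A, hA⟩ := exists_finite_charts π
  rw [isRealization_iff] at hX hU
  let f (i : ι) (l : Option (Fin (A i).dim)) : Γ(X, (A i).opens) :=
    l.elim 1 fun j => (A i).toSections (.X j)
  -- The point `x` is the image of `y` when, in some chart, every coordinate of `x` equals the
  -- pulled back coordinate at `y`. The index `none` ensures that `x` and `y` exist and lie over the
  -- chart even if it has no coordinates.
  have h : ∀ w : Fin SU.dim ⊕ Fin SX.dim → Ω,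
      (∃ a : SU.carrier, w = Sum.elim a.1 (eX (GeomPoint.map π g (eU.symm a))).1) ↔
      ∃ i, ∀ l, ∃ t : Unit → Ω,
        (∃ y : GeomPoint Ω (g ≫ π), ⊤ ≤ y.1 ⁻¹ᵁ (g ⁻¹ᵁ (A i).opens) ∧
          Sum.elim t (w ∘ Sum.inl) = Sum.elim
            (fun _ => secEval y.1 (g ⁻¹ᵁ (A i).opens) (g.app (A i).opens (f i l))) (eU y).1) ∧
        (∃ x : GeomPoint Ω π, ⊤ ≤ x.1 ⁻¹ᵁ (A i).opens ∧
          Sum.elim t (w ∘ Sum.inr) = Sum.elim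
            (fun _ => secEval x.1 (A i).opens (f i l)) (eX x).1) := by
    intro w
    have hg : ∀ (y : GeomPoint Ω (g ≫ π)) i (hy : ⊤ ≤ y.1 ⁻¹ᵁ (g ⁻¹ᵁ (A i).opens)) s,
        secEval y.1 (g ⁻¹ᵁ (A i).opens) (g.app (A i).opens s) =
          secEval (GeomPoint.map π g y).1 (A i).opens s := by
      intro y i hy s
      have hy' : ⊤ ≤ (GeomPoint.map π g y).1 ⁻¹ᵁ (A i).opens := hy
      rw [secEval_of_le hy, secEval_of_le hy']
      exact (secEvalHom_comp y.1 g _ hy s).symm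
    constructor
    · rintro ⟨a, rfl⟩
      obtain ⟨i, hi⟩ := hA ((GeomPoint.map π g (eU.symm a)).1 (IsLocalRing.closedPoint Ω))
      have hx := top_le_preimage_iff.2 hi
      refine ⟨i, fun l => ⟨fun _ => secEval (GeomPoint.map π g (eU.symm a)).1 (A i).opens (f i l),
        ⟨eU.symm a, hx, ?_⟩, ⟨GeomPoint.map π g (eU.symm a), hx, ?_⟩⟩⟩
      · rw [eU.apply_symm_apply, hg _ i hx]
        rfl
      · rfl
    · rintro ⟨i, hw⟩
      obtain ⟨t, ⟨y, hy, hty⟩, ⟨x, hx, htx⟩⟩ := hw none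
      have hb : w ∘ Sum.inl = (eU y).1 := funext fun j => congrFun hty (.inr j)
      have ha : w ∘ Sum.inr = (eX x).1 := funext fun j => congrFun htx (.inr j)
      have e : GeomPoint.map π g y = x := by
        refine AffineChart.eq_of_coord_eq (A := A i) hy hx (funext fun j => ?_)
        obtain ⟨t, ⟨y', hy', hty'⟩, ⟨x', hx', htx'⟩⟩ := hw (some j)
        have e1 : y' = y := eU.injective (Subtype.ext (.trans
          (funext fun j => (congrFun hty' (.inr j)).symm) hb))
        have e2 : x' = x := eX.injective (Subtype.ext (.trans
          (funext fun j => (congrFun htx' (.inr j)).symm) ha))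
        subst e1 e2
        exact (hg _ i hy' _).symm.trans
          ((congrFun hty' (.inl ())).symm.trans (congrFun htx' (.inl ())))
      refine ⟨eU y, ?_⟩
      rw [eU.symm_apply_apply, e, ← ha, ← hb]
      exact (Sum.elim_comp_inl_inr w).symm
  unfold DefSet.IsDefinableMap
  simp only [h]
  have hswap : ∀ (m : Type) (j : m → Fin SU.dim ⊕ Fin SX.dim)
      (w : (Fin SU.dim ⊕ Fin SX.dim) ⊕ Unit → Ω), Sum.elim (w ∘ Sum.inr) ((w ∘ Sum.inl) ∘ j) =
        w ∘ Sum.elim Sum.inr (Sum.inl ∘ j) := by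
    intro m j w
    funext i
    rcases i with i | i <;> rfl
  refine .exists_finite fun i => .forall_finite fun l => .exists_vector (.and ?_ ?_)
  · simp only [hswap]
    exact (hU _ _).preimage_comp _
  · simp only [hswap]
    exact (hX _ _).preimage_comp _

end Charts

/-! ### Existence of the motivic product. -/

theorem exists_isSchemeMotivicProduct {F Ω : Type u} [Field F] [Field Ω] [Algebra F Ω]
    {X U : Scheme.{u}} (π : X ⟶ Spec (.of F)) [LocallyOfFiniteType π]
    [QuasiCompact π] (g : U ⟶ X) [LocallyOfFiniteType g] [QuasiCompact g] :
    ∃ P : PowerSeries (GrothendieckRing F Ω), IsSchemeMotivicProduct Ω π g P := by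
  obtain ⟨SX, eX, hX⟩ := exists_isRealization (Ω := Ω) π
  obtain ⟨SU, eU, hU⟩ := exists_isRealization (Ω := Ω) (g ≫ π)
  have hf := isDefinableMap_geomPointMap π g hX hU
  choose c hc using exists_isMotivicCoeff hf
  refine ⟨.mk c, SX, SU, eX, eU, hX, hU, hf, fun n => ?_⟩
  rw [PowerSeries.coeff_mk]
  exact hc n

/-! ### Point count of the motivic product. -/

section Count

variable {F Ω : Type u} [Field F] [Finite F] [Field Ω] [Algebra F Ω] [IsAlgClosed Ω]
  {X U : Scheme.{u}}

/-- There are finitely many closed points of bounded degree, and the coefficients of the motivic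
product count the rational points of fibres over sets of closed points. -/
theorem pointCount_motivicProduct {π : X ⟶ Spec (.of F)} [LocallyOfFiniteType π] {g : U ⟶ X}
    {P : PowerSeries (GrothendieckRing F Ω)} (hP : IsSchemeMotivicProduct Ω π g P) :
    ∃ hfin : ∀ n, {v : ClosedPoint X | residueDegree π v.1 ≤ n}.Finite,
      ∀ n, pointCount F Ω (PowerSeries.coeff n P) =
        (∑ D ∈ (finite_setOf_sum_deg_eq hfin n).toFinset, ∏ v ∈ D, fiberCount g v.1 : ℕ) := by
  classical
  obtain ⟨SX, SU, eX, eU, hX, hU, hf, hc⟩ := hP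
  obtain ⟨σ, hσ⟩ := exists_frobenius F Ω
  have hfix : ∀ y : Ω, σ y = y ↔ y ∈ Set.range (algebraMap F Ω) := fun y => by
    rw [hσ, pow_natCard_eq_self_iff (algebraMap F Ω)]
  choose φ hφ using exists_pointOf_comp_eq (Ω := Ω) π
  let x (v : ClosedPoint X) : SX.carrier := eX ⟨pointOf v.1 (φ v), hφ v⟩
  have hdeg : ∀ v, Function.minimalPeriod (SX.perm σ) (x v) = residueDegree π v.1 :=
    fun v => minimalPeriod_pointOf hσ hX v.2 (φ v) (hφ v)
  have hpos : ∀ v : ClosedPoint X, 0 < residueDegree π v.1 := fun v => residueDegree_pos π v.2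
  -- Frobenius acts through the embedding of the residue field and does not move the underlying
  -- point of `X`.
  have hinj : ∀ v w k, (SX.perm σ)^[k] (x v) = x w → v = w := by
    intro v w k h
    have h1 := (hX.perm_iterate_eq_iff σ k _ _).1 h
    change _ ≫ pointOf _ _ = pointOf _ _ at h1
    rw [specMap_comp_pointOf] at h1
    exact Subtype.ext (pointOf_index_injective h1)
  have hx : ∀ z ∈ Function.periodicPts (SX.perm σ), ∃ v k, (SX.perm σ)^[k] (x v) = z := by
    intro z hz
    obtain ⟨v, hv⟩ := exists_orbit_of_periodic hσ hX hz
    exact ⟨v, hv (φ v) (hφ v)⟩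
  -- Distinct closed points have distinct base points, and those of degree at most `n` are fixed by
  -- some `σ ^ k` with `1 ≤ k ≤ n`.
  have hfin : ∀ n, {v : ClosedPoint X | residueDegree π v.1 ≤ n}.Finite := by
    intro n
    have h1 : (⋃ k ∈ Set.Icc 1 n, {a : SX.carrier | (SX.perm σ)^[k] a = a}).Finite :=
      (Set.finite_Icc 1 n).biUnion fun k hk => SX.finite_setOf_perm_iterate_eq hσ hk.1
    refine (h1.preimage (f := x) fun v _ w _ h => hinj v w 0 h).subset fun v hv => ?_
    refine Set.mem_biUnion (x := residueDegree π v.1) ⟨hpos v, hv⟩ ?_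
    exact iterate_deg hdeg v
  refine ⟨hfin, fun n => ?_⟩
  have hA : ∀ v, Finite {y : SU.carrier // eX (GeomPoint.map π g (eU.symm y)) = x v ∧
      (SU.perm σ)^[residueDegree π v.1] y = y} := fun v =>
    ((SU.finite_setOf_perm_iterate_eq hσ (hpos v)).subset fun y hy => hy.2 :
      {y : SU.carrier | eX (GeomPoint.map π g (eU.symm y)) = x v ∧
        (SU.perm σ)^[residueDegree π v.1] y = y}.Finite)
  rw [(hc n).pointCount_eq hfix, card_stable_eq_sum (fun y => hf.perm_comm σ y) hdeg hpos hx hinj n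
    (finite_setOf_sum_deg_eq hfin n) hA]
  congr 1
  exact Finset.sum_congr rfl fun D _ => Finset.prod_congr rfl fun v _ =>
    (fiberCount_eq hσ g hU v.2 (φ v) (hφ v)).symm

end Count

end MotivicEuler

end

/-! ### The main theorem. -/

open MotivicEuler

theorem mainTheorem10 {F Ω : Type u} [Field F] [Finite F] [Field Ω] [Algebra F Ω] [IsAlgClosed Ω]
    {X U : Scheme.{u}}
    (π : X ⟶ Spec (.of F)) [LocallyOfFiniteType π] [QuasiCompact π]
    (g : U ⟶ X) [LocallyOfFiniteType g] [QuasiCompact g]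
    (K : Type*) [CommRing K] [Algebra (GrothendieckRing F Ω) K] (μ : K →+* ℂ)
    (hμ : ∀ c : GrothendieckRing F Ω, μ (algebraMap (GrothendieckRing F Ω) K c) =
      (pointCount F Ω c : ℂ)) :
    (∃ P : PowerSeries (GrothendieckRing F Ω), IsSchemeMotivicProduct Ω π g P) ∧
    ∀ P : PowerSeries (GrothendieckRing F Ω), IsSchemeMotivicProduct Ω π g P →
      -- the identity of formal power series, the infinite product being coefficientwise stable
      (∀ N : ℕ, ∃ S₀ : Finset (ClosedPoint X), ∀ S : Finset (ClosedPoint X), S₀ ⊆ S →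
        PowerSeries.coeff N (∏ v ∈ S, (1 + PowerSeries.C (fiberCount g v.1 : ℂ) *
          (PowerSeries.X : PowerSeries ℂ) ^ residueDegree π v.1)) =
        μ (algebraMap (GrothendieckRing F Ω) K (PowerSeries.coeff N P))) ∧
      -- the identity of values, with absolute convergence, at `t = q ^ (-s)`
      ∀ s r : ℂ,
        (Summable fun v : ClosedPoint X =>
          ‖(fiberCount g v.1 : ℂ) * (residueCard v.1 : ℂ) ^ (-s)‖) →
        HasProd (fun v : ClosedPoint X =>
          1 + (fiberCount g v.1 : ℂ) * (residueCard v.1 : ℂ) ^ (-s)) r →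
        (Summable fun n : ℕ =>
          ‖μ (algebraMap (GrothendieckRing F Ω) K (PowerSeries.coeff n P)) *
            ((Nat.card F : ℂ) ^ (-s)) ^ n‖) ∧
        HasSum (fun n : ℕ =>
          μ (algebraMap (GrothendieckRing F Ω) K (PowerSeries.coeff n P)) *
            ((Nat.card F : ℂ) ^ (-s)) ^ n) r := by
  refine ⟨exists_isSchemeMotivicProduct π g, fun P hP => ?_⟩
  obtain ⟨hfin, hcount⟩ := pointCount_motivicProduct hP
  have hb : ∀ n, μ (algebraMap (GrothendieckRing F Ω) K (PowerSeries.coeff n P)) =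
      ((∑ D ∈ (finite_setOf_sum_deg_eq hfin n).toFinset, ∏ v ∈ D, fiberCount g v.1 : ℕ) : ℂ) := by
    intro n
    rw [hμ, hcount, Int.cast_natCast]
  have hq : ∀ (s : ℂ) (v : ClosedPoint X), (residueCard v.1 : ℂ) ^ (-s) =
      ((Nat.card F : ℂ) ^ (-s)) ^ residueDegree π v.1 := fun s v => by
    rw [residueCard_eq_pow π v.2, natCast_pow_cpow]
  refine ⟨fun N => ?_, fun s r hs hr => ?_⟩
  · rw [hb]
    exact exists_forall_coeff_prod_eq (fun v : ClosedPoint X => fiberCount g v.1) hfin N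
  · simp only [hb]
    simp only [hq] at hs hr
    exact summable_and_hasSum_of_hasProd (fun v : ClosedPoint X => fiberCount g v.1) hfin hs hr
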